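/- Let $d\ge 0$ be an integer and let $h:\mathbb R^d\to\mathbb R^d$, $f:\mathbb R^d\to[0,\infty)$, $W:\mathbb R^d\to[0,\infty)$ and a sequence of step sizes $a(n)\ge 0$, $n\ge 0$, be given. On a probability space let $y_0$ and $M_1,M_2,\dots$ be $\mathbb R^d$-valued random variables, put $\mathcal F_n=\sigma(y_0,M_1,\dots,M_n)$, and let $(y_n)$ be the adaptively scaled iterates $$y_{n+1}=y_n+\frac{a(n)}{g(y_n)}\bigl[h(y_n)+M_{n+1}\bigr],\qquad n\ge 0,$$ where $g$ is described below. Assume: (A1) $h$ is locally Lipschitz. (A2) $\sum_n a(n)=\infty$ and $\sum_n a(n)^2<\infty$. (A3) Each $M_{n+1}$, $n\ge 0$, is square integrable with $E[M_{n+1}\mid\mathcal F_n]=0$ a.s.; $f$ is measurable and locally bounded, and $E[\|M_{n+1}\|^2\mid\mathcal F_n]\le f(y_n)$ a.s. for all $n\ge 0$. (A4) $W(x)\to\infty$ as $\|x\|\to\infty$, and there is a positive integer $M$ such that $h(x)\cdot\nabla W(x)<0$ whenever $W(x)\ge M$. (A5) $W$ is twice continuously differentiable and all its second order partial derivatives are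 bounded in absolute value by a constant. Write $H^m=\{x:W(x)<m\}$ for $m\le\infty$ (so $H^\infty=\mathbb R^d$). Let $N$ be an integer or $\infty$ with $M<N\le\infty$ for which there is a finite constant $$c_N>\max\Bigl(1,\ \sup_{y\in\overline{H^N}\setminus H^M}\frac{\|h(y)\|^2+f(y)}{W(y)}\Bigr),$$ and let $g:\mathbb R^d\to\mathbb R$ be a measurable, locally bounded function such that for all $y\in\mathbb R^d$ $$g(y)\ \ge\ \max\Bigl(1,\ \mathbb I\{W(y)>N\}\sqrt{\frac{\|h(y)\|^2+f(y)}{W(y)}}\Bigr).$$ Then almost surely there is a (sample path dependent) internally chain transitive set $A$ of the o.d.e. $\dot x=h(x)$ such that $\operatorname{dist}(y_n,A)\to 0$ as $n\to\infty$. Here $A\subset\mathbb R^d$ is internally chain transitive for $\dot x=h(x)$ if it is nonempty and compact, invariant (through every point of $A$ there is a trajectory of the o.d.e. defined for all $t\in\mathbb R$ that stays in $A$), and for all $x,y\in A$, $\varepsilon>0$ and $T>0$ there are $n\ge 1$ and points $x_0=x,x_1,\dots,x_n=y$ in $A$ such that, for each $0\le i<n$, the trajectory started at $x_i$ is within distance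 less than $\varepsilon$ of $x_{i+1}$ at some time $t\ge T$. -/

import Mathlib

open MeasureTheory Filter Topology Set
open scoped ENNReal

namespace AdaptiveSA

/-- `ℝ^d` with the Euclidean norm. -/
abbrev Vec (d : ℕ) : Type := EuclideanSpace ℝ (Fin d)

/-- A real function is locally bounded: it is bounded on a neighbourhood of every point. -/
def LocallyBounded {d : ℕ} (f : Vec d → ℝ) : Prop :=
  ∀ x, ∃ U ∈ 𝓝 x, ∃ C : ℝ, ∀ y ∈ U, |f y| ≤ C

/-- The open sublevel set `H^m = {x | W x < m}` of a nonnegative function `W`,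
for `m ≤ ∞`; for `m = ∞` it is the whole space. -/
def sublevel {d : ℕ} (W : Vec d → ℝ) (m : ℕ∞) : Set (Vec d) :=
  {x | ENNReal.ofReal (W x) < (m : ℝ≥0∞)}

/-- The `σ`-algebra `F_n = σ(y₀, M₁, …, M_n)`. -/
abbrev history {Ω : Type*} {d : ℕ} (y₀ : Ω → Vec d) (M : ℕ → Ω → Vec d) (n : ℕ) :
    MeasurableSpace Ω :=
  MeasurableSpace.comap y₀ inferInstance ⊔
    ⨆ i ∈ Finset.Icc 1 n, MeasurableSpace.comap (M i) inferInstance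

/-- A set `A` is invariant for `ẋ = h(x)`: through each of its points there is a trajectory defined
for all times in `ℝ` that stays in `A`. (For locally Lipschitz `h` trajectories are unique.) -/
def Invariant {d : ℕ} (h : Vec d → Vec d) (A : Set (Vec d)) : Prop :=
  ∀ x ∈ A, ∃ γ : ℝ → Vec d, γ 0 = x ∧ (∀ t, HasDerivAt γ (h (γ t)) t) ∧ ∀ t, γ t ∈ A

/-- The forward trajectory of `ẋ = h(x)` started at `u` meets the `ε`-neighbourhood of `v` at some
time `t ≥ T`. -/
def Reaches {d : ℕ} (h : Vec d → Vec d) (ε T : ℝ) (u v : Vec d) : Prop :=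
  ∃ γ : ℝ → Vec d, γ 0 = u ∧
    (∀ t ∈ Ici (0 : ℝ), HasDerivWithinAt γ (h (γ t)) (Ici 0) t) ∧
    ∃ t, T ≤ t ∧ dist (γ t) v < ε

/-- Internally chain transitive sets of `ẋ = h(x)`: nonempty compact invariant sets in which any
two points are joined, for all `ε, T > 0`, by a finite chain of points of the set such that the
trajectory from each point of the chain comes `ε`-close to the next one after a time at
least `T`. -/
structure InternallyChainTransitive {d : ℕ} (h : Vec d → Vec d) (A : Set (Vec d)) : Prop where
  nonempty : A.Nonempty
  isCompact : IsCompact A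
  invariant : Invariant h A
  chain : ∀ x ∈ A, ∀ y ∈ A, ∀ ε > (0 : ℝ), ∀ T > (0 : ℝ),
    ∃ n : ℕ, 1 ≤ n ∧ ∃ p : ℕ → Vec d, p 0 = x ∧ p n = y ∧ (∀ i ≤ n, p i ∈ A) ∧
      ∀ i < n, Reaches h ε T (p i) (p (i + 1))

end AdaptiveSA

/-! The argument has two halves: almost sure boundedness of the iterates, then the o.d.e. method
along each bounded path.

Boundedness. Since `W` is only known to decrease along `h` far out, it is replaced by `ψ = ramp m ∘
W`, which is flat where `W ≤ m`, differs from `W` by a bounded amount and still has a Lipschitz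
gradient; now `∇ψ · h ≤ 0` everywhere (`exists_lyapunov`). In the Taylor expansion of `ψ` along one
step the drift term is nonpositive, the noise term has conditional mean zero, and the quadratic term
is controlled because the scaling forces `‖h‖² + f ≤ K (1 + W) g²` (`exists_growth_bound`). Hence
`E[ψ(y_{n+1}) | F_n] ≤ ψ(y_n) + C a(n)² (1 + ψ(y_n))`. As `a(n)²` is summable, the Robbins–Siegmund
argument (`ae_bddAbove_of_condExp_le`) bounds `ψ(y_n)`, and coercivity of `W` bounds `y_n`
(`ae_bddAbove_lyapunov`).

Convergence. Along a bounded path `f(y_n)` and `g(y_n)` are bounded. So the scaled noise has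
convergent sums (`ae_exists_tendsto_noise`), and the random steps `a(n) / g(y_n)` tend to zero with
divergent sum. A discrete Gronwall estimate (`norm_sub_trajectory_le`) makes the iterates shadow
trajectories over any bounded time span. The set of cluster points is then compact and invariant,
and long stretches of the iteration cut into pieces of moderate duration give the required chains
(`exists_internallyChainTransitive`). -/

namespace AdaptiveSA

/-! ### Lipschitz gradients and the truncation of `W`. -/

section Calculus

variable {E : Type*} [NormedAddCommGroup E] [InnerProductSpace ℝ E] [CompleteSpace E]

/-- Descent lemma, with a non-optimal constant. -/
theorem abs_sub_sub_inner_le {ψ : E → ℝ} {G : E → E} {L : ℝ}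
    (hψ : ∀ x, HasGradientAt ψ (G x) x) (hG : ∀ x y, ‖G x - G y‖ ≤ L * ‖x - y‖) (hL : 0 ≤ L)
    (x y : E) : |ψ y - ψ x - inner ℝ (G x) (y - x)| ≤ L * ‖y - x‖ ^ 2 := by
  have hs : Convex ℝ (segment ℝ x y) := convex_segment x y
  have key := hs.norm_image_sub_le_of_norm_hasFDerivWithin_le' (f := ψ)
    (f' := fun z => (InnerProductSpace.toDual ℝ E) (G z))
    (φ := (InnerProductSpace.toDual ℝ E) (G x)) (C := L * ‖y - x‖)
    (fun z _ => (hψ z).hasFDerivAt.hasFDerivWithinAt) (fun z hz => by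
      rw [← map_sub, LinearIsometryEquiv.norm_map]
      refine (hG z x).trans (mul_le_mul_of_nonneg_left ?_ hL)
      rw [segment_eq_image'] at hz
      obtain ⟨t, ht, rfl⟩ := hz
      simp only [add_sub_cancel_left, norm_smul, Real.norm_eq_abs, abs_of_nonneg ht.1]
      exact mul_le_of_le_one_left (norm_nonneg _) ht.2)
    (left_mem_segment ℝ x y) (right_mem_segment ℝ x y)
  simp only [InnerProductSpace.toDual_apply_apply, Real.norm_eq_abs] at key
  nlinarith [key]

/-- A nonnegative function with Lipschitz gradient dominates the square of the gradient. -/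
theorem norm_gradient_sq_le {ψ : E → ℝ} {G : E → E} {L : ℝ}
    (hψ : ∀ x, HasGradientAt ψ (G x) x) (hG : ∀ x y, ‖G x - G y‖ ≤ L * ‖x - y‖) (hL : 0 < L)
    (h0 : ∀ x, 0 ≤ ψ x) (x : E) : ‖G x‖ ^ 2 ≤ 4 * L * ψ x := by
  -- The step `1 / (2 * L)` minimizes the quadratic upper model along `-G x`; nonnegativity of `ψ`
  -- at the resulting point bounds the guaranteed decrease by `ψ x`.
  have h1 := abs_le.1 (abs_sub_sub_inner_le hψ hG hL.le x (x - (1 / (2 * L)) • G x))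
  have h2 := h0 (x - (1 / (2 * L)) • G x)
  have h3 : x - (1 / (2 * L)) • G x - x = -((1 / (2 * L)) • G x) := by abel
  rw [h3, inner_neg_right, inner_smul_right, real_inner_self_eq_norm_sq, norm_neg, norm_smul,
    Real.norm_eq_abs, abs_of_pos (by positivity)] at h1
  have h4 : L * (1 / (2 * L) * ‖G x‖) ^ 2 = 1 / (4 * L) * ‖G x‖ ^ 2 := by field_simp; ring
  have h5 : 1 / (2 * L) * ‖G x‖ ^ 2 - 1 / (4 * L) * ‖G x‖ ^ 2 ≤ ψ x := by
    rw [h4] at h1; linarith [h1.2]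
  have h6 : 1 / (2 * L) * ‖G x‖ ^ 2 - 1 / (4 * L) * ‖G x‖ ^ 2 = ‖G x‖ ^ 2 / (4 * L) := by
    field_simp; ring
  rw [h6, div_le_iff₀ (by positivity)] at h5
  linarith

/-- Half of the squared positive part. -/
noncomputable def halfSqPos (t : ℝ) : ℝ := (max 0 t) ^ 2 / 2

/-- The first order remainder is at most `(s - t) ^ 2` for every combination of signs, so the kink
of `max 0` at zero needs no separate treatment. -/
theorem hasDerivAt_halfSqPos (t : ℝ) : HasDerivAt halfSqPos (max 0 t) t := by
  have hb : ∀ s, |halfSqPos s - halfSqPos t - (max 0 t) * (s - t)| ≤ (s - t) ^ 2 := by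
    intro s
    unfold halfSqPos
    rcases le_total 0 s with hs | hs <;> rcases le_total 0 t with ht | ht <;>
      simp only [max_eq_left, max_eq_right, hs, ht] <;> rw [abs_le] <;>
      constructor <;> nlinarith [sq_nonneg (s - t), sq_nonneg s, sq_nonneg t]
  rw [hasDerivAt_iff_isLittleO]
  refine (Asymptotics.IsBigO.of_bound 1 (Eventually.of_forall fun s => ?_)).trans_isLittleO
    (Asymptotics.isLittleO_pow_sub_sub t one_lt_two)
  simpa [mul_comm] using hb s

/-- A `C¹` function that vanishes on `(-∞, m]` and has slope one on `[m + 1, ∞)`. -/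
noncomputable def ramp (m w : ℝ) : ℝ := halfSqPos (w - m) - halfSqPos (w - (m + 1))

/-- The derivative of `ramp m`. -/
noncomputable def rampDeriv (m w : ℝ) : ℝ := max 0 (w - m) - max 0 (w - (m + 1))

theorem hasDerivAt_ramp (m w : ℝ) : HasDerivAt (ramp m) (rampDeriv m w) w := by
  have h1 := (hasDerivAt_halfSqPos (w - m)).comp w ((hasDerivAt_id w).sub_const m)
  have h2 := (hasDerivAt_halfSqPos (w - (m + 1))).comp w ((hasDerivAt_id w).sub_const (m + 1))
  simpa using! h1.sub h2

theorem rampDeriv_of_le {m w : ℝ} (h : w ≤ m) : rampDeriv m w = 0 := by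
  unfold rampDeriv; grind

theorem rampDeriv_of_ge {m w : ℝ} (h : m + 1 ≤ w) : rampDeriv m w = 1 := by
  unfold rampDeriv; grind

theorem rampDeriv_nonneg (m w : ℝ) : 0 ≤ rampDeriv m w := by
  unfold rampDeriv; grind

theorem rampDeriv_le_one (m w : ℝ) : rampDeriv m w ≤ 1 := by
  unfold rampDeriv; grind

theorem abs_rampDeriv_sub_le (m v w : ℝ) : |rampDeriv m v - rampDeriv m w| ≤ |v - w| := by
  unfold rampDeriv; grind

theorem ramp_nonneg (m w : ℝ) : 0 ≤ ramp m w := by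
  have : max 0 (w - (m + 1)) ≤ max 0 (w - m) := by grind
  have : max 0 (w - (m + 1)) ^ 2 ≤ max 0 (w - m) ^ 2 := by gcongr
  unfold ramp halfSqPos; linarith

theorem sub_le_ramp (m w : ℝ) : w - (m + 1) ≤ ramp m w := by
  rcases le_total w (m + 1) with h | h
  · linarith [ramp_nonneg m w]
  · unfold ramp halfSqPos
    rw [max_eq_right (by linarith), max_eq_right (by linarith)]
    nlinarith

/-- Composing with `ramp` preserves Lipschitz continuity of the gradient. -/
theorem exists_lipschitz_rampDeriv_smul {W : E → ℝ} {D : E → E} {L m B : ℝ} (hL : 0 ≤ L)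
    (hW : ∀ x, HasGradientAt W (D x) x) (hD : ∀ x y, ‖D x - D y‖ ≤ L * ‖x - y‖)
    (hB : ∀ x, W x ≤ m + 1 → ‖D x‖ ≤ B) (hB0 : 0 ≤ B) :
    ∀ x y, ‖rampDeriv m (W x) • D x - rampDeriv m (W y) • D y‖
      ≤ (L + B * (B + L + 1)) * ‖x - y‖ := by
  -- By symmetry `y` may be the point with the lower value. Then either `W y ≤ m + 1`, where `D y`
  -- is bounded by `B`, or both slopes equal one and the term containing `D y` vanishes.
  have main : ∀ x y, W y ≤ W x → ‖rampDeriv m (W x) • D x - rampDeriv m (W y) • D y‖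
      ≤ (L + B * (B + L + 1)) * ‖x - y‖ := by
    intro x y hxy
    set r := ‖x - y‖ with hr
    have hr0 : 0 ≤ r := norm_nonneg _
    have e1 : rampDeriv m (W x) • D x - rampDeriv m (W y) • D y
        = rampDeriv m (W x) • (D x - D y) + (rampDeriv m (W x) - rampDeriv m (W y)) • D y := by
      module
    have e2 : ‖rampDeriv m (W x) • (D x - D y)‖ ≤ L * r := by
      rw [norm_smul, Real.norm_eq_abs, abs_of_nonneg (rampDeriv_nonneg _ _)]
      exact (mul_le_of_le_one_left (norm_nonneg _) (rampDeriv_le_one _ _)).trans (hD x y)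
    have e3 : ‖(rampDeriv m (W x) - rampDeriv m (W y)) • D y‖ ≤ B * (B + L + 1) * r := by
      rcases le_total (W y) (m + 1) with hy | hy
      · have hDy := hB y hy
        rw [norm_smul, Real.norm_eq_abs]
        have hk : |rampDeriv m (W x) - rampDeriv m (W y)| ≤ (B + L + 1) * r := by
          -- For `r ≤ 1` the quadratic Taylor remainder `L * r ^ 2` is absorbed into `L * r`; for `r
          -- ≥ 1` the slopes differ by at most `1 ≤ r`.
          rcases le_total r 1 with h1 | h1
          · have a1 := abs_rampDeriv_sub_le m (W x) (W y)
            have a2 := abs_sub_sub_inner_le hW hD hL y x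
            have a3 : |inner ℝ (D y) (x - y)| ≤ B * r :=
              (abs_real_inner_le_norm _ _).trans (mul_le_mul_of_nonneg_right hDy hr0)
            have a4 : |W x - W y| ≤ |W x - W y - inner ℝ (D y) (x - y)|
                + |inner ℝ (D y) (x - y)| := by
              simpa using abs_add_le (W x - W y - inner ℝ (D y) (x - y)) (inner ℝ (D y) (x - y))
            nlinarith [mul_nonneg hL (mul_nonneg hr0 (sub_nonneg.2 h1))]
          · have a1 := rampDeriv_nonneg m (W x)
            have a2 := rampDeriv_nonneg m (W y)
            have a3 := rampDeriv_le_one m (W x)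
            have a4 := rampDeriv_le_one m (W y)
            have : |rampDeriv m (W x) - rampDeriv m (W y)| ≤ 1 := by
              rw [abs_le]; constructor <;> linarith
            nlinarith [mul_nonneg (add_nonneg hB0 hL) hr0]
        calc _ ≤ ((B + L + 1) * r) * B :=
              mul_le_mul hk hDy (norm_nonneg _) (by positivity)
          _ = _ := by ring
      · rw [rampDeriv_of_ge hy, rampDeriv_of_ge (hy.trans hxy)]
        simp; positivity
    rw [e1]
    refine (norm_add_le _ _).trans ?_
    linarith
  intro x y
  rcases le_total (W y) (W x) with h | h
  · exact main x y h
  · rw [norm_sub_rev, norm_sub_rev x y]; exact main y x h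

end Calculus

/-- Bounded second partial derivatives make the gradient Lipschitz. -/
theorem exists_lipschitz_gradient {d : ℕ} {W : Vec d → ℝ} (hW : ContDiff ℝ 2 W)
    (hC : ∃ C : ℝ, ∀ (x : Vec d) (i j : Fin d),
      |fderiv ℝ (fun z => fderiv ℝ W z (EuclideanSpace.single j (1 : ℝ))) x
        (EuclideanSpace.single i (1 : ℝ))| ≤ C) :
    ∃ L : ℝ, 0 ≤ L ∧ ∀ x y, ‖gradient W x - gradient W y‖ ≤ L * ‖x - y‖ := by
  obtain ⟨C, hC⟩ := hC
  have hbd : ∀ (T : Vec d →L[ℝ] ℝ) (K : ℝ), (∀ i, |T (EuclideanSpace.single i (1 : ℝ))| ≤ K) →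
      ‖T‖ ≤ d * |K| := by
    intro T K hT
    refine T.opNorm_le_bound (by positivity) fun v => ?_
    have hv : v = ∑ i, v i • EuclideanSpace.single i (1 : ℝ) := by
      ext j; simp [Finset.sum_apply, Pi.single_apply]
    conv_lhs => rw [hv]
    rw [map_sum]
    refine (norm_sum_le _ _).trans ?_
    calc ∑ i, ‖T (v i • EuclideanSpace.single i (1 : ℝ))‖ ≤ ∑ _i : Fin d, |K| * ‖v‖ := by
          refine Finset.sum_le_sum fun i _ => ?_
          rw [map_smul, norm_smul, mul_comm]
          exact mul_le_mul ((hT i).trans (le_abs_self _)) (PiLp.norm_apply_le v i)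
            (norm_nonneg _) (abs_nonneg _)
      _ = d * |K| * ‖v‖ := by simp; ring
  have hd : ∀ j : Fin d, Differentiable ℝ
      (fun z => fderiv ℝ W z (EuclideanSpace.single j (1 : ℝ))) := fun j => by
    have : ContDiff ℝ 1 (fderiv ℝ W) := hW.fderiv_right (by norm_num)
    exact (this.differentiable (by norm_num)).clm_apply (differentiable_const _)
  have hlip : ∀ (j : Fin d) x y, |fderiv ℝ W x (EuclideanSpace.single j (1 : ℝ))
      - fderiv ℝ W y (EuclideanSpace.single j (1 : ℝ))| ≤ d * |C| * ‖x - y‖ := fun j x y =>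
    Convex.norm_image_sub_le_of_norm_fderiv_le (𝕜 := ℝ) (s := univ)
      (f := fun z => fderiv ℝ W z (EuclideanSpace.single j (1 : ℝ)))
      (fun z _ => hd j z) (fun z _ => hbd _ _ fun i => hC z i j) convex_univ
      (mem_univ y) (mem_univ x)
  refine ⟨d * (d * |C|), by positivity, fun x y => ?_⟩
  unfold gradient
  rw [← map_sub, LinearIsometryEquiv.norm_map]
  refine (hbd _ (d * |C| * ‖x - y‖) fun j => by simpa using hlip j x y).trans_eq ?_
  rw [abs_of_nonneg (by positivity)]; ring

end AdaptiveSA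

/-! ### The Lyapunov function and the growth bound obtained from the scaling. -/

namespace AdaptiveSA

variable {d : ℕ}

theorem LocallyBounded.exists_bound {f : Vec d → ℝ} (hf : LocallyBounded f) (R : ℝ) :
    ∃ C : ℝ, 0 ≤ C ∧ ∀ x, ‖x‖ ≤ R → |f x| ≤ C := by
  choose U hU C hC using hf
  obtain ⟨t, -, ht⟩ := (isCompact_closedBall (0 : Vec d) R).elim_nhds_subcover U fun x _ => hU x
  refine ⟨∑ x ∈ t, |C x|, Finset.sum_nonneg fun _ _ => abs_nonneg _, fun x hx => ?_⟩
  have := ht (mem_closedBall_zero_iff.2 hx)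
  simp only [mem_iUnion, exists_prop] at this
  obtain ⟨z, hz, hxz⟩ := this
  exact ((hC z x hxz).trans (le_abs_self _)).trans
    (Finset.single_le_sum (f := fun x => |C x|) (fun _ _ => abs_nonneg _) hz)

theorem _root_.Continuous.locallyBounded {f : Vec d → ℝ} (hf : Continuous f) :
    LocallyBounded f := fun x =>
  ⟨{y | |f y| < |f x| + 1}, (isOpen_lt hf.abs continuous_const).mem_nhds (by simp),
    |f x| + 1, fun _ hy => hy.le⟩

theorem exists_norm_le_of_le {W : Vec d → ℝ}
    (hW : Tendsto W (Bornology.cobounded (Vec d)) atTop) (r : ℝ) :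
    ∃ R : ℝ, ∀ x, W x ≤ r → ‖x‖ ≤ R := by
  have h1 := hW.eventually (eventually_gt_atTop r)
  obtain ⟨R, -, hR⟩ := (hasBasis_cobounded_norm (E := Vec d)).eventually_iff.1 h1
  refine ⟨R, fun x hx => ?_⟩
  by_contra hlt
  exact absurd (hR (show R ≤ ‖x‖ from (not_le.1 hlt).le)) (not_lt.2 hx)

/-- A function with globally Lipschitz gradient that decreases along the vector field. -/
theorem exists_lyapunov {h : Vec d → Vec d} {W : Vec d → ℝ} {m : ℝ}
    (hW_coercive : Tendsto W (Bornology.cobounded (Vec d)) atTop)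
    (hW_desc : ∀ x, m ≤ W x → inner ℝ (h x) (gradient W x) < 0)
    (hW_smooth : ContDiff ℝ 2 W)
    (hW_second : ∃ C : ℝ, ∀ (x : Vec d) (i j : Fin d),
      |fderiv ℝ (fun z => fderiv ℝ W z (EuclideanSpace.single j (1 : ℝ))) x
        (EuclideanSpace.single i (1 : ℝ))| ≤ C) :
    ∃ (ψ : Vec d → ℝ) (G : Vec d → Vec d) (L : ℝ), 0 < L ∧
      (∀ x, HasGradientAt ψ (G x) x) ∧ (∀ x y, ‖G x - G y‖ ≤ L * ‖x - y‖) ∧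
      (∀ x, 0 ≤ ψ x) ∧ (∀ x, inner ℝ (G x) (h x) ≤ 0) ∧ ∀ x, W x ≤ ψ x + (m + 1) := by
  obtain ⟨L, hL, hlip⟩ := exists_lipschitz_gradient hW_smooth hW_second
  have hgrad : ∀ x, HasGradientAt W (gradient W x) x := fun x =>
    ((hW_smooth.differentiable (by norm_num)) x).hasGradientAt
  have hcont : Continuous (gradient W) :=
    (LipschitzWith.of_dist_le_mul (K := L.toNNReal)
      fun x y => by simpa [dist_eq_norm, hL] using hlip x y).continuous
  -- The slope is constant above level `m + 1`, so the gradient of `W` needs a bound only on the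
  -- bounded set where `W ≤ m + 1`.
  obtain ⟨R, hR⟩ := exists_norm_le_of_le hW_coercive (m + 1)
  obtain ⟨B, hB0, hB⟩ := (hcont.norm.locallyBounded).exists_bound R
  refine ⟨fun x => ramp m (W x), fun x => rampDeriv m (W x) • gradient W x,
    (L + B * (B + L + 1)) + 1, by positivity, fun x => ?_, fun x y => ?_,
    fun x => ramp_nonneg _ _, fun x => ?_, fun x => by linarith [sub_le_ramp m (W x)]⟩
  · have := (hasDerivAt_ramp m (W x)).comp_hasFDerivAt x (hgrad x).hasFDerivAt
    rw [hasGradientAt_iff_hasFDerivAt, map_smul]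
    exact this
  · refine (exists_lipschitz_rampDeriv_smul hL hgrad hlip
      (fun x hx => (le_abs_self _).trans (hB x (hR x hx))) hB0 x y).trans ?_
    exact mul_le_mul_of_nonneg_right (by linarith) (norm_nonneg _)
  · rw [inner_smul_left, real_inner_comm]
    rcases le_total m (W x) with hx | hx
    · exact mul_nonpos_of_nonneg_of_nonpos (rampDeriv_nonneg _ _) (hW_desc x hx).le
    · simp [rampDeriv_of_le hx]

/-- The scaled drift and noise grow at most like the Lyapunov function. -/
theorem exists_growth_bound {h : Vec d → Vec d} {f g W : Vec d → ℝ} {M₀ : ℕ} {N : ℕ∞} {c : ℝ}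
    (hh : Continuous h) (hf_bdd : LocallyBounded f)
    (hW_nonneg : ∀ x, 0 ≤ W x)
    (hW_coercive : Tendsto W (Bornology.cobounded (Vec d)) atTop)
    (hM₀ : 0 < M₀)
    (hc : max 1 (⨆ z ∈ closure (sublevel W N) \ sublevel W M₀,
      ENNReal.ofReal ((‖h z‖ ^ 2 + f z) / W z)) < ENNReal.ofReal c)
    (hg : ∀ z, max 1 ({z | (N : ℝ≥0∞) < ENNReal.ofReal (W z)}.indicator
      (fun z => √((‖h z‖ ^ 2 + f z) / W z)) z) ≤ g z) :
    ∃ K : ℝ, 0 ≤ K ∧ ∀ z, ‖h z‖ ^ 2 + f z ≤ K * (1 + W z) * g z ^ 2 := by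
  have hbdd : ∀ r : ℝ, ∃ K : ℝ, 0 ≤ K ∧ ∀ z, W z ≤ r → ‖h z‖ ^ 2 + f z ≤ K := by
    intro r
    obtain ⟨R, hR⟩ := exists_norm_le_of_le hW_coercive r
    obtain ⟨B, hB0, hB⟩ := ((hh.norm.pow 2).locallyBounded).exists_bound R
    obtain ⟨C, hC0, hC⟩ := hf_bdd.exists_bound R
    exact ⟨B + C, by positivity, fun z hz => add_le_add ((le_abs_self _).trans (hB z (hR z hz)))
      ((le_abs_self _).trans (hC z (hR z hz)))⟩
  have hg1 : ∀ z, 1 ≤ g z := fun z => (le_max_left _ _).trans (hg z)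
  have hlift : ∀ (K : ℝ) z, 0 ≤ K → K * (1 + W z) ≤ K * (1 + W z) * g z ^ 2 := fun K z hK =>
    le_mul_of_one_le_right (mul_nonneg hK (by linarith [hW_nonneg z]))
      (one_le_pow₀ (hg1 z))
  -- For `N = ∞` the indicator in `hg` is identically zero and the growth bound comes from `c`
  -- outside `H^{M₀}`. For finite `N` it comes from `g` where `W > N`. The remaining set is bounded
  -- in either case, and local boundedness covers it.
  cases N with
  | top =>
    obtain ⟨K, hK0, hK⟩ := hbdd M₀
    have hc0 : 0 < c := by
      by_contra hneg
      rw [ENNReal.ofReal_of_nonpos (not_lt.1 hneg)] at hc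
      exact not_lt_zero hc
    refine ⟨K + c, by positivity, fun z => le_trans ?_ (hlift _ z (by positivity))⟩
    have hWz := hW_nonneg z
    rcases lt_or_ge (W z) M₀ with hz | hz
    · have := hK z hz.le
      nlinarith [mul_nonneg hK0 hWz, mul_nonneg hc0.le hWz]
    · have hpos : 0 < W z := lt_of_lt_of_le (by exact_mod_cast hM₀) hz
      have hmem : z ∈ closure (sublevel W ⊤) \ sublevel W M₀ := by
        refine ⟨subset_closure (by simp [sublevel]), ?_⟩
        simp only [sublevel, mem_ofPred_eq, not_lt, ENat.toENNReal_coe]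
        rw [← ENNReal.ofReal_natCast]
        exact ENNReal.ofReal_le_ofReal hz
      have h1 : ENNReal.ofReal ((‖h z‖ ^ 2 + f z) / W z) < ENNReal.ofReal c :=
        lt_of_le_of_lt (le_iSup₂_of_le z hmem le_rfl) ((le_max_right _ _).trans_lt hc)
      have h2 := ((ENNReal.ofReal_lt_ofReal_iff hc0).1 h1).le
      rw [div_le_iff₀ hpos] at h2
      nlinarith [mul_nonneg hK0 hWz]
  | coe n =>
    obtain ⟨K, hK0, hK⟩ := hbdd n
    refine ⟨K + 1, by positivity, fun z => ?_⟩
    have hWz := hW_nonneg z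
    rcases le_or_gt (W z) n with hz | hz
    · refine le_trans ?_ (hlift _ z (by positivity))
      have := hK z hz
      nlinarith [mul_nonneg hK0 hWz]
    · have hpos : 0 < W z := lt_of_le_of_lt (Nat.cast_nonneg n) hz
      have hmem : z ∈ {z | ((n : ℕ∞) : ℝ≥0∞) < ENNReal.ofReal (W z)} := by
        simp only [mem_ofPred_eq, ENat.toENNReal_coe]
        rw [← ENNReal.ofReal_natCast]
        exact (ENNReal.ofReal_lt_ofReal_iff hpos).2 hz
      have h1 := (le_max_right _ _).trans (hg z)
      rw [indicator_of_mem hmem] at h1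
      have h2 := (Real.sqrt_le_left (by linarith [hg1 z])).1 h1
      rw [div_le_iff₀ hpos] at h2
      have h3 : 0 ≤ (K + K * W z + 1) * g z ^ 2 := by positivity
      nlinarith

end AdaptiveSA

/-! ### Almost supermartingales and square summable martingale differences. -/

namespace AdaptiveSA

section Martingales

variable {Ω : Type*} {m0 : MeasurableSpace Ω} {μ : Measure Ω} [IsProbabilityMeasure μ]
  {ℱ : Filtration ℕ m0}

/-- A nonnegative supermartingale is almost surely bounded. -/
theorem ae_bddAbove_of_supermartingale {U : ℕ → Ω → ℝ} (hU : Supermartingale U ℱ μ)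
    (h0 : ∀ n ω, 0 ≤ U n ω) : ∀ᵐ ω ∂μ, ∃ C, ∀ n, U n ω ≤ C := by
  have hbdd : ∀ n, eLpNorm ((-U) n) 1 μ ≤ ((∫ ω, U 0 ω ∂μ).toNNReal : ℝ≥0∞) := fun n => by
    have h1 : ∫ ω, U n ω ∂μ ≤ ∫ ω, U 0 ω ∂μ := by
      simpa using hU.setIntegral_le (Nat.zero_le n) MeasurableSet.univ
    rw [Pi.neg_apply, eLpNorm_neg, eLpNorm_one_eq_lintegral_enorm,
      ← ofReal_integral_norm_eq_lintegral_enorm (hU.integrable n)]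
    refine ENNReal.ofReal_le_ofReal ?_
    simpa only [Real.norm_eq_abs, abs_of_nonneg (h0 n _)] using h1
  filter_upwards [hU.neg.exists_ae_tendsto_of_bdd hbdd] with ω hω
  obtain ⟨l, hl⟩ := hω
  obtain ⟨C, hC⟩ := hl.neg.bddAbove_range
  exact ⟨C, fun n => by simpa using hC (mem_range_self n)⟩

/-- An almost supermartingale in the sense of Robbins and Siegmund is almost surely bounded. -/
theorem ae_bddAbove_of_condExp_le {V : ℕ → Ω → ℝ} {α : ℕ → ℝ} (hα : ∀ n, 0 ≤ α n)
    (hαs : Summable α) (hadp : StronglyAdapted ℱ V) (hint : ∀ n, Integrable (V n) μ)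
    (h0 : ∀ n ω, 0 ≤ V n ω)
    (hV : ∀ n, μ[V (n + 1) | ℱ n] ≤ᵐ[μ] fun ω => V n ω + α n * (1 + V n ω)) :
    ∀ᵐ ω ∂μ, ∃ C, ∀ n, V n ω ≤ C := by
  -- The hypothesis says that `V + 1` grows in conditional mean by a factor of at most `1 + α n`.
  -- Dividing by the accumulated factor `P n` gives a supermartingale, and summability of `α` keeps
  -- `P` bounded.
  set P : ℕ → ℝ := fun n => ∏ i ∈ Finset.range n, (1 + α i) with hP
  have hP1 : ∀ n, 0 < P n := fun n => Finset.prod_pos fun i _ => by linarith [hα i]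
  have hPs : ∀ n, P (n + 1) = P n * (1 + α n) := fun n => Finset.prod_range_succ _ _
  have hPB : ∀ n, P n ≤ Real.exp (∑' i, α i) := fun n => by
    calc P n ≤ ∏ i ∈ Finset.range n, Real.exp (α i) :=
          Finset.prod_le_prod (fun i _ => by linarith [hα i])
            fun i _ => by linarith [Real.add_one_le_exp (α i)]
      _ = Real.exp (∑ i ∈ Finset.range n, α i) := (Real.exp_sum _ _).symm
      _ ≤ _ := Real.exp_le_exp.2 (hαs.sum_le_tsum _ fun i _ => hα i)
  set U : ℕ → Ω → ℝ := fun n => (P n)⁻¹ • (V n + fun _ => 1) with hU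
  have hUint : ∀ n, Integrable (U n) μ := fun n => ((hint n).add (integrable_const 1)).smul _
  have hsup : Supermartingale U ℱ μ := by
    refine supermartingale_nat (fun n => ((hadp n).add stronglyMeasurable_const).const_smul _)
      hUint fun n => ?_
    have e1 := condExp_smul (μ := μ) (P (n + 1))⁻¹ (V (n + 1) + fun _ => (1 : ℝ)) (ℱ n)
    have e2 := condExp_add (hint (n + 1)) (integrable_const (1 : ℝ)) (ℱ n)
    filter_upwards [e1, e2, hV n] with ω h1 h2 h3
    rw [h1, Pi.smul_apply, h2, Pi.add_apply, condExp_const (ℱ.le n), hPs]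
    simp only [hU, Pi.smul_apply, Pi.add_apply, smul_eq_mul]
    have hα1 : 0 < 1 + α n := by linarith [hα n]
    calc (P n * (1 + α n))⁻¹ * ((μ[V (n + 1) | ℱ n]) ω + 1)
        ≤ (P n * (1 + α n))⁻¹ * ((1 + α n) * (V n ω + 1)) := by
          refine mul_le_mul_of_nonneg_left (by nlinarith) ?_
          have := hP1 n
          positivity
      _ = (P n)⁻¹ * (V n ω + 1) := by
          have := (hP1 n).ne'
          field_simp
  filter_upwards [ae_bddAbove_of_supermartingale hsup fun n ω => by
    have := hP1 n
    have := h0 n ω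
    simp only [hU, Pi.smul_apply, Pi.add_apply, smul_eq_mul]
    positivity] with ω hω
  obtain ⟨C, hC⟩ := hω
  refine ⟨Real.exp (∑' i, α i) * |C|, fun n => ?_⟩
  have h1 := hC n
  simp only [hU, Pi.smul_apply, Pi.add_apply, smul_eq_mul] at h1
  rw [inv_mul_le_iff₀ (hP1 n)] at h1
  have h2 : P n * C ≤ Real.exp (∑' i, α i) * |C| :=
    -- The side goal is `0 ≤ C`, which follows from `0 < V n ω + 1 ≤ P n * C`.
    mul_le_mul (hPB n) (le_abs_self C) (by
      by_contra hneg
      have := h0 n ω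
      nlinarith [hP1 n]) (Real.exp_pos _).le
  linarith

/-- Square summable martingale differences have almost surely convergent sums. -/
theorem ae_exists_tendsto_sum_of_summable_sq {X : ℕ → Ω → ℝ}
    (hadp : ∀ n, StronglyMeasurable[ℱ (n + 1)] (X n)) (hX : ∀ n, MemLp (X n) 2 μ)
    (hmart : ∀ n, μ[X n | ℱ n] =ᵐ[μ] 0) (hsum : Summable fun n => ∫ ω, X n ω ^ 2 ∂μ) :
    ∀ᵐ ω ∂μ, ∃ l, Tendsto (fun n => ∑ i ∈ Finset.range n, X i ω) atTop (𝓝 l) := by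
  set S : ℕ → Ω → ℝ := fun n ω => ∑ i ∈ Finset.range n, X i ω with hS
  have hSs : ∀ n, S (n + 1) = S n + X n := fun n => by
    ext ω; simp [hS, Finset.sum_range_succ]
  have hSadp : StronglyAdapted ℱ S := fun n =>
    Finset.stronglyMeasurable_fun_sum _ fun i hi =>
      (hadp i).mono (ℱ.mono (Nat.succ_le_of_lt (Finset.mem_range.1 hi)))
  have hSL : ∀ n, MemLp (S n) 2 μ := fun n => memLp_finsetSum _ fun i _ => hX i
  have hSint : ∀ n, Integrable (S n) μ := fun n => (hSL n).integrable (by norm_num)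
  have hM : Martingale S ℱ μ := martingale_of_condExp_sub_eq_zero_nat hSadp hSint fun n => by
    rw [hSs, add_sub_cancel_left]; exact hmart n
  -- Increments are orthogonal to the past, so second moments add up; the resulting `L²` bound gives
  -- the `L¹` bound required for martingale convergence.
  have hcross : ∀ n, ∫ ω, S n ω * X n ω ∂μ = 0 := fun n => by
    have hXi : Integrable (X n) μ := (hX n).integrable (by norm_num)
    have hprod : Integrable (S n * X n) μ := (hSL n).integrable_mul (hX n)
    have h1 := condExp_mul_of_stronglyMeasurable_left (hSadp n) hprod hXi
    have h2 : ∫ ω, (S n * X n) ω ∂μ = ∫ ω, (μ[S n * X n | ℱ n]) ω ∂μ :=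
      (integral_condExp (ℱ.le n)).symm
    have h3 : μ[S n * X n | ℱ n] =ᵐ[μ] 0 := by
      filter_upwards [h1, hmart n] with ω e1 e2
      rw [e1, Pi.mul_apply, e2]; simp
    rw [integral_congr_ae h3] at h2
    simpa using h2
  have hsq : ∀ n, ∫ ω, S n ω ^ 2 ∂μ = ∑ i ∈ Finset.range n, ∫ ω, X i ω ^ 2 ∂μ := by
    intro n
    induction n with
    | zero => simp [hS]
    | succ n ih =>
      rw [Finset.sum_range_succ, ← ih]
      have e : ∀ ω, S (n + 1) ω ^ 2 = S n ω ^ 2 + 2 * (S n ω * X n ω) + X n ω ^ 2 := fun ω => by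
        rw [hSs, Pi.add_apply]; ring
      have i1 : Integrable (fun ω => S n ω ^ 2) μ := (hSL n).integrable_sq
      have i2 : Integrable (fun ω => 2 * (S n ω * X n ω)) μ :=
        ((hSL n).integrable_mul (hX n)).const_mul 2
      have i3 : Integrable (fun ω => S n ω ^ 2 + 2 * (S n ω * X n ω)) μ := i1.add i2
      simp_rw [e]
      rw [integral_add i3 (hX n).integrable_sq, integral_add i1 i2, integral_const_mul,
        hcross]
      ring
  set T := ∑' n, ∫ ω, X n ω ^ 2 ∂μ with hT
  have hbdd : ∀ n, eLpNorm (S n) 1 μ ≤ ((1 + T).toNNReal : ℝ≥0∞) := fun n => by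
    rw [eLpNorm_one_eq_lintegral_enorm, ← ofReal_integral_norm_eq_lintegral_enorm (hSint n)]
    refine ENNReal.ofReal_le_ofReal ?_
    calc ∫ ω, ‖S n ω‖ ∂μ ≤ ∫ ω, (1 + S n ω ^ 2) ∂μ := by
          refine integral_mono (hSint n).norm ((integrable_const 1).add (hSL n).integrable_sq)
            fun ω => ?_
          simp only [Real.norm_eq_abs]
          nlinarith [sq_nonneg (|S n ω| - 1), sq_abs (S n ω)]
      _ = 1 + ∫ ω, S n ω ^ 2 ∂μ := by
          rw [integral_add (integrable_const 1) (hSL n).integrable_sq]; simp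
      _ ≤ 1 + T := by
          rw [hsq]
          gcongr
          exact hsum.sum_le_tsum _ fun i _ => integral_nonneg fun ω => sq_nonneg _
  exact hM.submartingale.exists_ae_tendsto_of_bdd hbdd

end Martingales

end AdaptiveSA

/-! ### Stability of the iteration and convergence of the scaled noise. -/

namespace AdaptiveSA

section Iteration

variable {Ω : Type*} {m0 : MeasurableSpace Ω} {μ : Measure Ω} [IsProbabilityMeasure μ]
  {ℱ : Filtration ℕ m0} {d : ℕ}

/-- The drift contributes nothing positive to first order. Splitting `‖u + v‖ ^ 2` doubles the
constant `L`, but separates the drift, known at time `n`, from the noise. -/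
theorem lyapunov_step_le {ψ : Vec d → ℝ} {G : Vec d → Vec d} {L : ℝ} (hL : 0 < L)
    (hψ : ∀ x, HasGradientAt ψ (G x) x) (hG : ∀ x y, ‖G x - G y‖ ≤ L * ‖x - y‖)
    {x u v : Vec d} {β : ℝ} (hβ : 0 ≤ β) (hu : inner ℝ (G x) u ≤ 0) :
    ψ (x + β • (u + v)) ≤ ψ x + β * inner ℝ (G x) v
      + 2 * L * (β ^ 2 * ‖u‖ ^ 2) + 2 * L * (β ^ 2 * ‖v‖ ^ 2) := by
  have h1 := (abs_le.1 (abs_sub_sub_inner_le hψ hG hL.le x (x + β • (u + v)))).2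
  rw [add_sub_cancel_left, inner_smul_right, inner_add_right, norm_smul, mul_pow,
    Real.norm_eq_abs, sq_abs] at h1
  have h2 : ‖u + v‖ ^ 2 ≤ 2 * (‖u‖ ^ 2 + ‖v‖ ^ 2) := by
    have := norm_add_le u v
    nlinarith [sq_nonneg (‖u‖ - ‖v‖), norm_nonneg (u + v)]
  have h3 : L * (β ^ 2 * ‖u + v‖ ^ 2) ≤ L * (β ^ 2 * (2 * (‖u‖ ^ 2 + ‖v‖ ^ 2))) := by gcongr
  have h4 : β * inner ℝ (G x) u ≤ 0 := mul_nonpos_of_nonneg_of_nonpos hβ hu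
  linarith

/-- Conditional expectation of the upper bound for the increment of a Lyapunov function. -/
theorem condExp_lyapunov_bound {m : MeasurableSpace Ω} (hm : m ≤ m0)
    {Z : Ω → ℝ} {D X : Ω → Vec d} {β f : Ω → ℝ} {A κ : ℝ}
    (hZ : StronglyMeasurable[m] Z) (hZi : Integrable Z μ)
    (hD : StronglyMeasurable[m] D) (hD2 : MemLp D 2 μ)
    (hβ : StronglyMeasurable[m] β) (hβA : ∀ ω, |β ω| ≤ A) (hκ : 0 ≤ κ)
    (hX2 : MemLp X 2 μ) (hX : μ[X | m] =ᵐ[μ] 0)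
    (hXf : μ[fun ω => ‖X ω‖ ^ 2 | m] ≤ᵐ[μ] f) :
    Integrable (fun ω => Z ω + inner ℝ (D ω) (X ω) + κ * (β ω ^ 2 * ‖X ω‖ ^ 2)) μ ∧
      μ[fun ω => Z ω + inner ℝ (D ω) (X ω) + κ * (β ω ^ 2 * ‖X ω‖ ^ 2) | m]
        ≤ᵐ[μ] fun ω => Z ω + κ * (β ω ^ 2 * f ω) := by
  have hXi : Integrable X μ := hX2.integrable (by norm_num)
  have hXn : Integrable (fun ω => ‖X ω‖ ^ 2) μ :=
    (memLp_two_iff_integrable_sq_norm hX2.1).1 hX2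
  have hDn : Integrable (fun ω => ‖D ω‖ ^ 2) μ :=
    (memLp_two_iff_integrable_sq_norm hD2.1).1 hD2
  have hin : Integrable (fun ω => inner ℝ (D ω) (X ω)) μ := by
    refine (hDn.add hXn).mono' (hD2.1.inner hX2.1) (Eventually.of_forall fun ω => ?_)
    refine (norm_inner_le_norm _ _).trans ?_
    simp only [Pi.add_apply]
    nlinarith [sq_nonneg (‖D ω‖ - ‖X ω‖), sq_nonneg (‖D ω‖ + ‖X ω‖)]
  have hβ2 : StronglyMeasurable[m] (fun ω => κ * β ω ^ 2) := (hβ.pow 2).const_mul κ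
  have hq : Integrable ((fun ω => κ * β ω ^ 2) * fun ω => ‖X ω‖ ^ 2) μ := by
    refine (hXn.const_mul (κ * A ^ 2)).mono' ((hβ2.mono hm).aestronglyMeasurable.mul hXn.1)
      (Eventually.of_forall fun ω => ?_)
    have : β ω ^ 2 ≤ A ^ 2 := sq_le_sq' (abs_le.1 (hβA ω)).1 (abs_le.1 (hβA ω)).2
    rw [Pi.mul_apply, Real.norm_eq_abs, abs_of_nonneg (by positivity)]
    gcongr
  have heq : (fun ω => Z ω + inner ℝ (D ω) (X ω) + κ * (β ω ^ 2 * ‖X ω‖ ^ 2))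
      = (Z + fun ω => inner ℝ (D ω) (X ω)) + ((fun ω => κ * β ω ^ 2) * fun ω => ‖X ω‖ ^ 2) := by
    ext ω; simp only [Pi.add_apply, Pi.mul_apply]; ring
  rw [heq]
  refine ⟨(hZi.add hin).add hq, ?_⟩
  have e1 := condExp_add (hZi.add hin) hq m
  have e2 := condExp_add hZi hin m
  have e3 : μ[Z | m] = Z := condExp_of_stronglyMeasurable hm hZ hZi
  have e4 : μ[fun ω => inner ℝ (D ω) (X ω) | m] =ᵐ[μ] fun ω => inner ℝ (D ω) (μ[X | m] ω) :=
    condExp_bilin_of_stronglyMeasurable_left (innerSL ℝ : Vec d →L[ℝ] Vec d →L[ℝ] ℝ) hD hin hXi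
  have e5 := condExp_mul_of_stronglyMeasurable_left hβ2 hq hXn
  filter_upwards [e1, e2, e4, e5, hX, hXf] with ω h1 h2 h4 h5 h6 h7
  rw [h1, Pi.add_apply, h2, Pi.add_apply, e3, h4, h5, h6, Pi.mul_apply]
  simp only [Pi.zero_apply, inner_zero_right, add_zero]
  have : 0 ≤ κ * β ω ^ 2 := by positivity
  nlinarith [mul_le_mul_of_nonneg_left h7 this]

/-- Almost sure stability of the scaled iteration. -/
theorem ae_bddAbove_lyapunov {h : Vec d → Vec d} {f ψ : Vec d → ℝ} {G : Vec d → Vec d}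
    {a : ℕ → ℝ} {b : ℕ → Ω → ℝ} {M y : ℕ → Ω → Vec d} {K L : ℝ}
    (hh : Continuous h) (hf : ∀ x, 0 ≤ f x) (hK : 0 ≤ K) (hL : 0 < L)
    (ha : Summable fun n => a n ^ 2)
    (hM_sq : ∀ n, MemLp (M (n + 1)) 2 μ) (hM_mart : ∀ n, μ[M (n + 1) | ℱ n] =ᵐ[μ] 0)
    (hM_var : ∀ n, μ[fun ω => ‖M (n + 1) ω‖ ^ 2 | ℱ n] ≤ᵐ[μ] fun ω => f (y n ω))
    (hy_meas : ∀ n, StronglyMeasurable[ℱ n] (y n))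
    (hb_meas : ∀ n, StronglyMeasurable[ℱ n] (b n))
    (hb0 : ∀ n ω, 0 ≤ b n ω) (hba : ∀ n ω, b n ω ≤ a n)
    (hy : ∀ n ω, y (n + 1) ω = y n ω + b n ω • (h (y n ω) + M (n + 1) ω))
    (hψ : ∀ x, HasGradientAt ψ (G x) x) (hG : ∀ x y, ‖G x - G y‖ ≤ L * ‖x - y‖)
    (hψ0 : ∀ x, 0 ≤ ψ x) (hGh : ∀ x, inner ℝ (G x) (h x) ≤ 0)
    (hgrow : ∀ n ω, b n ω ^ 2 * (‖h (y n ω)‖ ^ 2 + f (y n ω)) ≤ a n ^ 2 * (K * (1 + ψ (y n ω)))) :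
    ∀ᵐ ω ∂μ, ∃ C, ∀ n, ψ (y n ω) ≤ C := by
  have hψc : Continuous ψ := continuous_iff_continuousAt.2 fun x => (hψ x).continuousAt
  have hGc : Continuous G :=
    (LipschitzWith.of_dist_le_mul (K := L.toNNReal)
      fun x y => by simpa [dist_eq_norm, hL.le] using hG x y).continuous
  have hloc : ∀ R : ℕ, ∀ᵐ ω ∂μ, ψ (y 0 ω) ≤ R → ∃ C, ∀ n, ψ (y n ω) ≤ C := by
    intro R
    -- No moment of `y 0` is assumed, so `ψ (y 0)` need not be integrable. Restricting to this `ℱ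
    -- 0`-measurable event makes it bounded, and the countably many events exhaust `Ω`. Since `χ ^ 2
    -- = χ`, the indicator passes through the quadratic estimates.
    set B : Set Ω := {ω | ψ (y 0 ω) ≤ R} with hB
    have hBm : MeasurableSet[ℱ 0] B :=
      (hψc.comp_stronglyMeasurable (hy_meas 0)).measurable measurableSet_Iic
    set χ : Ω → ℝ := B.indicator fun _ => 1 with hχ
    have hχm : ∀ n, StronglyMeasurable[ℱ n] χ := fun n =>
      stronglyMeasurable_const.indicator (ℱ.mono (Nat.zero_le n) _ hBm)
    have hχ01 : ∀ ω, χ ω = 0 ∨ χ ω = 1 := fun ω => by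
      by_cases hω : ω ∈ B <;> simp [hχ, hω]
    have hχ0 : ∀ ω, 0 ≤ χ ω := fun ω => by rcases hχ01 ω with e | e <;> simp [e]
    have hχ1 : ∀ ω, χ ω ≤ 1 := fun ω => by rcases hχ01 ω with e | e <;> simp [e]
    have hχ2 : ∀ ω, χ ω ^ 2 = χ ω := fun ω => by rcases hχ01 ω with e | e <;> simp [e]
    set V : ℕ → Ω → ℝ := fun n ω => χ ω * ψ (y n ω) with hV
    have hV0 : ∀ n ω, 0 ≤ V n ω := fun n ω => mul_nonneg (hχ0 ω) (hψ0 _)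
    have hVm : StronglyAdapted ℱ V := fun n =>
      (hχm n).mul (hψc.comp_stronglyMeasurable (hy_meas n))
    set β : ℕ → Ω → ℝ := fun n ω => χ ω * b n ω with hβ
    have hβm : ∀ n, StronglyMeasurable[ℱ n] (β n) := fun n => (hχm n).mul (hb_meas n)
    have hβ0 : ∀ n ω, 0 ≤ β n ω := fun n ω => mul_nonneg (hχ0 ω) (hb0 n ω)
    have hβa : ∀ n ω, β n ω ≤ a n := fun n ω =>
      (mul_le_of_le_one_left (hb0 n ω) (hχ1 ω)).trans (hba n ω)
    have hβ2 : ∀ n ω, β n ω ^ 2 = χ ω * b n ω ^ 2 := fun n ω => by rw [hβ, mul_pow, hχ2]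
    set D : ℕ → Ω → Vec d := fun n ω => β n ω • G (y n ω) with hD
    have hDm : ∀ n, StronglyMeasurable[ℱ n] (D n) := fun n =>
      (hβm n).smul (hGc.comp_stronglyMeasurable (hy_meas n))
    set E : ℕ → Ω → ℝ := fun n ω => β n ω ^ 2 * ‖h (y n ω)‖ ^ 2 with hE
    have hEm : ∀ n, StronglyMeasurable[ℱ n] (E n) := fun n =>
      ((hβm n).pow 2).mul (((hh.comp_stronglyMeasurable (hy_meas n)).norm).pow 2)
    have hgrow' : ∀ n ω, E n ω + β n ω ^ 2 * f (y n ω) ≤ a n ^ 2 * K * (1 + V n ω) := by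
      intro n ω
      have h1 := mul_le_mul_of_nonneg_left (hgrow n ω) (hχ0 ω)
      have h2 : χ ω * (a n ^ 2 * (K * (1 + ψ (y n ω)))) ≤ a n ^ 2 * K * (1 + V n ω) := by
        have h3 : χ ω * (1 + ψ (y n ω)) ≤ 1 + V n ω := by simp only [hV]; linarith [hχ1 ω]
        calc _ = a n ^ 2 * K * (χ ω * (1 + ψ (y n ω))) := by ring
          _ ≤ _ := mul_le_mul_of_nonneg_left h3 (by positivity)
      simp only [hE, hβ2]
      linarith
    have hstep : ∀ n ω, V (n + 1) ω ≤ (V n ω + 2 * L * E n ω)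
        + inner ℝ (D n ω) (M (n + 1) ω) + 2 * L * (β n ω ^ 2 * ‖M (n + 1) ω‖ ^ 2) := by
      intro n ω
      have h1 := mul_le_mul_of_nonneg_left (lyapunov_step_le hL hψ hG (v := M (n + 1) ω)
        (hb0 n ω) (hGh (y n ω))) (hχ0 ω)
      rw [← hy] at h1
      refine h1.trans_eq ?_
      simp only [hV, hE, hD, hβ2, inner_smul_left, conj_trivial]
      simp only [hβ]
      ring
    have hVint : ∀ n, Integrable (V n) μ → Integrable (fun ω => V n ω + 2 * L * E n ω) μ ∧
        MemLp (D n) 2 μ := by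
      intro n hn
      have hEi : Integrable (E n) μ := by
        refine (((integrable_const (1 : ℝ)).add hn).const_mul (a n ^ 2 * K)).mono'
          ((hEm n).mono (ℱ.le n)).aestronglyMeasurable (Eventually.of_forall fun ω => ?_)
        have h1 := hgrow' n ω
        have h2 : 0 ≤ β n ω ^ 2 * f (y n ω) := mul_nonneg (sq_nonneg _) (hf _)
        have h3 : 0 ≤ E n ω := by simp only [hE]; positivity
        rw [Real.norm_eq_abs, abs_of_nonneg h3]
        simp only [Pi.add_apply]
        linarith
      refine ⟨hn.add (hEi.const_mul (2 * L)), ?_⟩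
      have hDs := ((hDm n).mono (ℱ.le n)).aestronglyMeasurable (μ := μ)
      rw [memLp_two_iff_integrable_sq_norm hDs]
      refine (hn.const_mul (a n ^ 2 * (4 * L))).mono' (hDs.norm.pow 2)
        (Eventually.of_forall fun ω => ?_)
      -- Because the squared gradient is dominated by `ψ` itself, integrability of `V n` already
      -- makes `D n` square integrable.
      have h1 := norm_gradient_sq_le hψ hG hL hψ0 (y n ω)
      have h2 : b n ω ^ 2 ≤ a n ^ 2 := pow_le_pow_left₀ (hb0 n ω) (hba n ω) 2
      rw [Real.norm_eq_abs, abs_of_nonneg (by positivity)]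
      calc ‖D n ω‖ ^ 2 = χ ω * (b n ω ^ 2 * ‖G (y n ω)‖ ^ 2) := by
            simp only [hD, norm_smul, mul_pow, Real.norm_eq_abs, sq_abs, hβ2]; ring
        _ ≤ χ ω * (a n ^ 2 * (4 * L * ψ (y n ω))) := by
            have := hχ0 ω
            gcongr
        _ = _ := by simp only [hV]; ring
    have hβabs : ∀ n ω, |β n ω| ≤ a n := fun n ω => by
      rw [abs_of_nonneg (hβ0 n ω)]; exact hβa n ω
    have hbound := fun n (hn : Integrable (V n) μ) =>
      condExp_lyapunov_bound (ℱ.le n) (κ := 2 * L)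
        ((hVm n).add ((hEm n).const_mul (2 * L))) (hVint n hn).1 (hDm n) (hVint n hn).2
        (hβm n) (hβabs n) (by positivity) (hM_sq n) (hM_mart n) (hM_var n)
    -- Integrability propagates by induction, since the bound `hbound` for step `n + 1` requires it
    -- only at step `n`.
    have hint : ∀ n, Integrable (V n) μ := by
      intro n
      induction n with
      | zero =>
        refine (integrable_const (R : ℝ)).mono'
          ((hVm 0).mono (ℱ.le 0)).aestronglyMeasurable (Eventually.of_forall fun ω => ?_)
        rw [Real.norm_eq_abs, abs_of_nonneg (hV0 0 ω)]
        by_cases hω : ω ∈ B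
        · have hω' : ψ (y 0 ω) ≤ R := hω
          simpa [hV, hχ, hω] using hω'
        · simp [hV, hχ, hω]
      | succ n ih =>
        refine (hbound n ih).1.mono' ((hVm (n + 1)).mono (ℱ.le _)).aestronglyMeasurable
          (Eventually.of_forall fun ω => ?_)
        rw [Real.norm_eq_abs, abs_of_nonneg (hV0 _ ω)]
        exact hstep n ω
    have hcond : ∀ n, μ[V (n + 1) | ℱ n] ≤ᵐ[μ]
        fun ω => V n ω + 2 * L * K * a n ^ 2 * (1 + V n ω) := by
      intro n
      filter_upwards [condExp_mono (m := ℱ n) (hint (n + 1)) (hbound n (hint n)).1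
        (Eventually.of_forall (hstep n)), (hbound n (hint n)).2] with ω h1 h2
      refine h1.trans (h2.trans ?_)
      have h3 := mul_le_mul_of_nonneg_left (hgrow' n ω) (show 0 ≤ 2 * L by positivity)
      simp only [Pi.add_apply]
      linarith
    filter_upwards [ae_bddAbove_of_condExp_le (fun n => by positivity) (ha.mul_left (2 * L * K))
      hVm hint hV0 hcond] with ω hω hωB
    obtain ⟨C, hC⟩ := hω
    refine ⟨C, fun n => ?_⟩
    have hmem : ω ∈ B := hωB
    simpa [hV, hχ, hmem] using hC n
  filter_upwards [ae_all_iff.2 hloc] with ω hω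
  obtain ⟨R, hR⟩ := exists_nat_ge (ψ (y 0 ω))
  exact hω R hR

/-- The accumulated scaled noise converges along bounded paths. -/
theorem ae_exists_tendsto_noise {f : Vec d → ℝ} {a : ℕ → ℝ} {b : ℕ → Ω → ℝ}
    {M y : ℕ → Ω → Vec d} (hf_bdd : LocallyBounded f)
    (ha : Summable fun n => a n ^ 2) (hM_meas : ∀ n, StronglyMeasurable[ℱ (n + 1)] (M (n + 1)))
    (hM_sq : ∀ n, MemLp (M (n + 1)) 2 μ) (hM_mart : ∀ n, μ[M (n + 1) | ℱ n] =ᵐ[μ] 0)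
    (hM_var : ∀ n, μ[fun ω => ‖M (n + 1) ω‖ ^ 2 | ℱ n] ≤ᵐ[μ] fun ω => f (y n ω))
    (hy_meas : ∀ n, StronglyMeasurable[ℱ n] (y n))
    (hb_meas : ∀ n, StronglyMeasurable[ℱ n] (b n))
    (hb0 : ∀ n ω, 0 ≤ b n ω) (hba : ∀ n ω, b n ω ≤ a n) :
    ∀ᵐ ω ∂μ, (∃ C, ∀ n, ‖y n ω‖ ≤ C) →
      ∃ l, Tendsto (fun n => ∑ i ∈ Finset.range n, b i ω • M (i + 1) ω) atTop (𝓝 l) := by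
  have hloc : ∀ (R : ℕ) (j : Fin d), ∀ᵐ ω ∂μ, (∀ n, ‖y n ω‖ ≤ R) →
      ∃ l, Tendsto (fun n => ∑ i ∈ Finset.range n, b i ω * M (i + 1) ω j) atTop (𝓝 l) := by
    intro R j
    obtain ⟨C, hC0, hC⟩ := hf_bdd.exists_bound R
    -- The truncation is `ℱ n`-measurable, so it preserves the martingale property while bounding
    -- the conditional variance by `a n ^ 2 * C`. On paths staying in the ball of radius `R` it
    -- changes nothing.
    set ρ : ℕ → Ω → ℝ := fun n => {ω | ‖y n ω‖ ≤ R}.indicator (b n) with hρ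
    have hρm : ∀ n, StronglyMeasurable[ℱ n] (ρ n) := fun n =>
      (hb_meas n).indicator ((hy_meas n).norm.measurable measurableSet_Iic)
    have hρ0 : ∀ n ω, 0 ≤ ρ n ω := fun n ω => indicator_nonneg (fun _ _ => hb0 n _) _
    have hρa : ∀ n ω, ρ n ω ≤ a n := fun n ω =>
      (indicator_le_self' (fun _ _ => hb0 n _) ω).trans (hba n ω)
    have hρ2 : ∀ n ω, ρ n ω ^ 2 ≤ a n ^ 2 := fun n ω => pow_le_pow_left₀ (hρ0 n ω) (hρa n ω) 2
    set X : ℕ → Ω → ℝ := fun n => ρ n * fun ω => M (n + 1) ω j with hX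
    have hMj : ∀ n, StronglyMeasurable[ℱ (n + 1)] fun ω => M (n + 1) ω j := fun n =>
      (EuclideanSpace.proj (𝕜 := ℝ) j).continuous.comp_stronglyMeasurable (hM_meas n)
    have hMj2 : ∀ n, MemLp (fun ω => M (n + 1) ω j) 2 μ := fun n =>
      (hM_sq n).of_le ((hMj n).mono (ℱ.le _)).aestronglyMeasurable
        (Eventually.of_forall fun ω => PiLp.norm_apply_le _ j)
    have hXm : ∀ n, StronglyMeasurable[ℱ (n + 1)] (X n) := fun n =>
      ((hρm n).mono (ℱ.mono n.le_succ)).mul (hMj n)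
    have hXL : ∀ n, MemLp (X n) 2 μ := fun n => by
      refine ((hMj2 n).const_mul (a n)).of_le ((hXm n).mono (ℱ.le _)).aestronglyMeasurable
        (Eventually.of_forall fun ω => ?_)
      simp only [hX, Pi.mul_apply, norm_mul]
      gcongr
      rw [Real.norm_eq_abs, Real.norm_eq_abs, abs_of_nonneg (hρ0 n ω)]
      exact (hρa n ω).trans (le_abs_self _)
    have hXmart : ∀ n, μ[X n | ℱ n] =ᵐ[μ] 0 := fun n => by
      have e1 := condExp_mul_of_stronglyMeasurable_left (hρm n)
        ((hXL n).integrable (by norm_num)) ((hMj2 n).integrable (by norm_num))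
      have e2 := ContinuousLinearMap.comp_condExp_comm (m := ℱ n)
        ((hM_sq n).integrable (by norm_num)) (EuclideanSpace.proj (𝕜 := ℝ) j)
      filter_upwards [e1, e2, hM_mart n] with ω h1 h2 h3
      simp only [hX]
      rw [h1, Pi.mul_apply]
      have h4 : μ[fun ω => M (n + 1) ω j | ℱ n] ω = 0 := by
        refine Eq.trans h2.symm ?_
        simp [Function.comp_apply, h3]
      rw [h4]; simp
    have hXsum : Summable fun n => ∫ ω, X n ω ^ 2 ∂μ := by
      refine Summable.of_nonneg_of_le (fun n => integral_nonneg fun ω => sq_nonneg _)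
        (fun n => ?_) (ha.mul_right C)
      have hMn : Integrable (fun ω => ‖M (n + 1) ω‖ ^ 2) μ :=
        (memLp_two_iff_integrable_sq_norm (hM_sq n).1).1 (hM_sq n)
      have hρs : StronglyMeasurable[ℱ n] (fun ω => ρ n ω ^ 2) := (hρm n).pow 2
      have hq : Integrable ((fun ω => ρ n ω ^ 2) * fun ω => ‖M (n + 1) ω‖ ^ 2) μ := by
        refine (hMn.const_mul (a n ^ 2)).mono'
          ((hρs.mono (ℱ.le n)).aestronglyMeasurable.mul hMn.1) (Eventually.of_forall fun ω => ?_)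
        rw [Pi.mul_apply, Real.norm_eq_abs, abs_of_nonneg (by positivity)]
        exact mul_le_mul_of_nonneg_right (hρ2 n ω) (by positivity)
      calc ∫ ω, X n ω ^ 2 ∂μ
          ≤ ∫ ω, ((fun ω => ρ n ω ^ 2) * fun ω => ‖M (n + 1) ω‖ ^ 2) ω ∂μ := by
            refine integral_mono (hXL n).integrable_sq hq fun ω => ?_
            simp only [hX, Pi.mul_apply, mul_pow]
            refine mul_le_mul_of_nonneg_left ?_ (sq_nonneg _)
            rw [← sq_abs]
            exact pow_le_pow_left₀ (abs_nonneg _) (PiLp.norm_apply_le (M (n + 1) ω) j) 2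
        _ = ∫ ω, (μ[(fun ω => ρ n ω ^ 2) * fun ω => ‖M (n + 1) ω‖ ^ 2 | ℱ n]) ω ∂μ :=
            (integral_condExp (ℱ.le n)).symm
        _ ≤ ∫ _ω, a n ^ 2 * C ∂μ := by
            refine integral_mono_ae integrable_condExp (integrable_const _) ?_
            filter_upwards [condExp_mul_of_stronglyMeasurable_left hρs hq hMn, hM_var n]
              with ω h1 h2
            rw [h1, Pi.mul_apply]
            by_cases hω : ‖y n ω‖ ≤ R
            · have h3 := (h2.trans (le_abs_self _)).trans (hC _ hω)
              exact (mul_le_mul_of_nonneg_left h3 (sq_nonneg _)).trans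
                (mul_le_mul_of_nonneg_right (hρ2 n ω) hC0)
            · have : ρ n ω = 0 := by simp [hρ, hω]
              rw [this]
              simp only [ne_eq, OfNat.ofNat_ne_zero, not_false_eq_true, zero_pow, zero_mul]
              positivity
        _ = a n ^ 2 * C := by simp
    filter_upwards [ae_exists_tendsto_sum_of_summable_sq hXm hXL hXmart hXsum] with ω hω hR
    obtain ⟨l, hl⟩ := hω
    refine ⟨l, hl.congr fun n => Finset.sum_congr rfl fun i _ => ?_⟩
    simp [hX, hρ, hR i]
  filter_upwards [ae_all_iff.2 fun R => ae_all_iff.2 (hloc R)] with ω hω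
  rintro ⟨C, hC⟩
  obtain ⟨R, hR⟩ := exists_nat_ge C
  choose l hl using fun j => hω R j fun n => (hC n).trans hR
  refine ⟨WithLp.toLp 2 l, ?_⟩
  have h1 : Tendsto (fun n => WithLp.toLp 2 fun j =>
      ∑ i ∈ Finset.range n, b i ω * M (i + 1) ω j) atTop (𝓝 (WithLp.toLp 2 l : Vec d)) :=
    ((PiLp.continuous_toLp 2 _).tendsto l).comp (tendsto_pi_nhds.2 hl)
  refine h1.congr fun n => ?_
  ext j
  simp

end Iteration

end AdaptiveSA

/-! ### Global trajectories and their approximation by perturbed Euler schemes. -/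

namespace AdaptiveSA

/-- A locally Lipschitz map agrees on any ball with a bounded, globally Lipschitz one. -/
theorem exists_lipschitz_bounded_extension {d : ℕ} {h : Vec d → Vec d} (hh : LocallyLipschitz h)
    (R : ℝ) : ∃ (F : Vec d → Vec d) (L : NNReal) (H : ℝ), LipschitzWith L F ∧ 0 ≤ H ∧
      (∀ x, ‖F x‖ ≤ H) ∧ ∀ x, ‖x‖ ≤ R → F x = h x := by
  set S : ℝ := |R| with hS
  have hS0 : 0 ≤ S := abs_nonneg R
  -- Coordinatewise clamping is a 1-Lipschitz retraction onto a cube containing the ball of radius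
  -- `R`. On a closed ball containing this cube `h` is bounded and Lipschitz by compactness, hence
  -- so is `h ∘ κ` everywhere.
  set κ : Vec d → Vec d := fun x => WithLp.toLp 2 fun i => max (-S) (min S (x i)) with hκ
  have hκL : LipschitzWith 1 κ := LipschitzWith.of_dist_le_mul fun x y => by
    rw [NNReal.coe_one, one_mul, EuclideanSpace.dist_eq, EuclideanSpace.dist_eq]
    refine Real.sqrt_le_sqrt (Finset.sum_le_sum fun i _ => ?_)
    refine pow_le_pow_left₀ dist_nonneg ?_ 2
    simp only [hκ, Real.dist_eq]
    grind
  have hκb : ∀ x, ‖κ x‖ ≤ Real.sqrt (∑ _i : Fin d, S ^ 2) := fun x => by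
    rw [EuclideanSpace.norm_eq]
    refine Real.sqrt_le_sqrt (Finset.sum_le_sum fun i _ => ?_)
    rw [Real.norm_eq_abs]
    refine pow_le_pow_left₀ (abs_nonneg _) ?_ 2
    simp only [hκ]
    grind
  set R' := Real.sqrt (∑ _i : Fin d, S ^ 2) with hR'
  have hcomp : IsCompact (Metric.closedBall (0 : Vec d) R') := isCompact_closedBall _ _
  obtain ⟨L, hL⟩ := (hh.locallyLipschitzOn (s := Metric.closedBall (0 : Vec d) R')
    ).exists_lipschitzOnWith_of_compact hcomp
  obtain ⟨H, hH⟩ := hcomp.exists_bound_of_continuousOn hL.continuousOn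
  have hmem : ∀ x, κ x ∈ Metric.closedBall (0 : Vec d) R' := fun x =>
    mem_closedBall_zero_iff.2 (hκb x)
  refine ⟨h ∘ κ, L, H, ?_, (norm_nonneg _).trans (hH _ (hmem 0)), fun x => hH _ (hmem x), ?_⟩
  · have := hL.comp (hκL.lipschitzOnWith (s := univ)) (fun x _ => hmem x)
    rwa [mul_one, lipschitzOnWith_univ] at this
  · intro x hx
    have : κ x = x := by
      ext i
      have h1 := PiLp.norm_apply_le x i
      rw [Real.norm_eq_abs] at h1
      have h2 : |x i| ≤ S := h1.trans (hx.trans (le_abs_self R))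
      have h3 := abs_le.1 h2
      simp only [hκ]
      rw [min_eq_right h3.2, max_eq_right h3.1]
    simp [Function.comp_apply, this]

section Flow

variable {E : Type*} [NormedAddCommGroup E] [NormedSpace ℝ E]

/-- A trajectory of an autonomous differential equation, defined for all times. -/
def IsTrajectory (F : E → E) (γ : ℝ → E) : Prop := ∀ t, HasDerivAt γ (F (γ t)) t

theorem IsTrajectory.eq {F : E → E} {L : NNReal} (hF : LipschitzWith L F) {γ₁ γ₂ : ℝ → E}
    (h₁ : IsTrajectory F γ₁) (h₂ : IsTrajectory F γ₂) {t₀ : ℝ} (h : γ₁ t₀ = γ₂ t₀) : γ₁ = γ₂ :=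
  ODE_solution_unique_univ (v := fun _ => F) (s := fun _ => univ) (K := L)
    (fun _ => hF.lipschitzOnWith) (fun t => ⟨h₁ t, mem_univ _⟩) (fun t => ⟨h₂ t, mem_univ _⟩) h

theorem IsTrajectory.comp_add {F : E → E} {γ : ℝ → E} (h : IsTrajectory F γ) (s : ℝ) :
    IsTrajectory F fun t => γ (t + s) := fun t => (h (t + s)).comp_add_const t s

/-- A bounded Lipschitz vector field has global trajectories. -/
theorem exists_isTrajectory [CompleteSpace E] {F : E → E} {L : NNReal} {H : ℝ}
    (hF : LipschitzWith L F) (hH0 : 0 ≤ H) (hH : ∀ x, ‖F x‖ ≤ H) (p : E) :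
    ∃ γ : ℝ → E, γ 0 = p ∧ IsTrajectory F γ := by
  have hloc : ∀ n : ℕ, ∃ α : ℝ → E, α 0 = p ∧
      ∀ t ∈ Ioo (-(n + 1 : ℝ)) (n + 1), HasDerivAt α (F (α t)) t := by
    intro n
    have hn : (0 : ℝ) ∈ Icc (-(n + 1 : ℝ)) (n + 1) := ⟨by linarith, by positivity⟩
    have hPL : IsPicardLindelof (fun _ => F) (⟨0, hn⟩ : Icc (-(n + 1 : ℝ)) (n + 1)) p
        (H.toNNReal * (n + 1)) 0 H.toNNReal L :=
      { lipschitzOnWith := fun _ _ => hF.lipschitzOnWith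
        continuousOn := fun _ _ => continuousOn_const
        norm_le := fun _ _ x _ => by simpa [hH0] using hH x
        mul_max_le := by simp }
    obtain ⟨α, hα0, hα⟩ := hPL.exists_eq_forall_mem_Icc_hasDerivWithinAt₀
    exact ⟨α, hα0, fun t ht => (hα t (Ioo_subset_Icc_self ht)).hasDerivAt (Icc_mem_nhds ht.1 ht.2)⟩
  choose α hα0 hα using hloc
  have heq : ∀ n m : ℕ, n ≤ m → ∀ t : ℝ, |t| ≤ n → α n t = α m t := by
    intro n m hnm t ht
    have hnm' : (n : ℝ) ≤ m := by exact_mod_cast hnm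
    refine ODE_solution_unique_of_mem_Ioo (v := fun _ => F) (s := fun _ => univ) (K := L)
      (a := -(n + 1 : ℝ)) (b := n + 1) (t₀ := 0) (fun _ _ => hF.lipschitzOnWith)
      ⟨by linarith, by positivity⟩ (fun s hs => ⟨hα n s hs, mem_univ _⟩)
      (fun s hs => ⟨hα m s ⟨by linarith [hs.1], by linarith [hs.2]⟩, mem_univ _⟩)
      (by rw [hα0, hα0]) ⟨by linarith [(abs_le.1 ht).1], by linarith [(abs_le.1 ht).2]⟩
  -- The local solutions agree on overlaps by uniqueness, so near each `t` the glued curve coincides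
  -- with a single `α m`.
  refine ⟨fun t => α ⌈|t|⌉₊ t, by simp [hα0], fun t => ?_⟩
  set m := ⌈|t|⌉₊ + 1 with hm
  have htm : |t| < m := by
    rw [hm]; push_cast; linarith [Nat.le_ceil |t|]
  have hmem : t ∈ Ioo (-(m + 1 : ℝ)) (m + 1) :=
    ⟨by linarith [(abs_lt.1 htm).1], by linarith [(abs_lt.1 htm).2]⟩
  have hval : ∀ s : ℝ, |s| < m → α ⌈|s|⌉₊ s = α m s := fun s hs =>
    heq _ _ (Nat.ceil_le.2 hs.le) s (Nat.le_ceil _)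
  have hev : (fun s => α ⌈|s|⌉₊ s) =ᶠ[𝓝 t] α m := by
    filter_upwards [(isOpen_lt continuous_abs continuous_const).mem_nhds
      (show t ∈ {s : ℝ | |s| < m} from htm)] with s hs using hval s hs
  have := (hα m t hmem).congr_of_eventuallyEq hev
  rwa [← hval t htm] at this

theorem IsTrajectory.norm_sub_le {F : E → E} {γ : ℝ → E} {H : ℝ} (h : IsTrajectory F γ)
    (hH : ∀ x, ‖F x‖ ≤ H) (s t : ℝ) : ‖γ t - γ s‖ ≤ H * |t - s| :=
  Convex.norm_image_sub_le_of_norm_hasDerivWithin_le (s := univ)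
    (fun u _ => (h u).hasDerivWithinAt) (fun u _ => hH (γ u)) convex_univ (mem_univ s) (mem_univ t)

/-- After subtracting the linear motion `t • F (γ s)`, the derivative on the interval is at most `L
* H * b`. The error is quadratic in `b`: one factor is later bounded by the largest step, the other
is summed. -/
theorem IsTrajectory.norm_euler_sub_le {F : E → E} {γ : ℝ → E} {L : NNReal} {H : ℝ}
    (h : IsTrajectory F γ) (hF : LipschitzWith L F) (hH : ∀ x, ‖F x‖ ≤ H) (s : ℝ) {b : ℝ}
    (hb : 0 ≤ b) : ‖γ (s + b) - (γ s + b • F (γ s))‖ ≤ L * H * b * b := by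
  have key := Convex.norm_image_sub_le_of_norm_hasDerivWithin_le (s := Icc s (s + b))
    (f := fun t => γ t - t • F (γ s)) (f' := fun t => F (γ t) - F (γ s)) (C := L * H * b)
    (x := s) (y := s + b)
    (fun u _ => by
      have h1 : HasDerivAt (fun t : ℝ => t • F (γ s)) ((1 : ℝ) • F (γ s)) u :=
        (hasDerivAt_id u).smul_const _
      rw [one_smul] at h1
      exact ((h u).sub h1).hasDerivWithinAt)
    (fun u hu => by
      have h1 := hF.dist_le_mul (γ u) (γ s)
      rw [dist_eq_norm, dist_eq_norm] at h1
      have h2 := h.norm_sub_le hH s u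
      rw [abs_of_nonneg (by linarith [hu.1])] at h2
      have h3 : H * (u - s) ≤ H * b :=
        mul_le_mul_of_nonneg_left (by linarith [hu.2]) ((norm_nonneg _).trans (hH 0))
      calc _ ≤ (L : ℝ) * ‖γ u - γ s‖ := h1
        _ ≤ L * (H * b) := by gcongr; exact h2.trans h3
        _ = _ := by ring)
    (convex_Icc _ _) ⟨le_rfl, by linarith⟩ ⟨by linarith, le_rfl⟩
  rw [add_sub_cancel_left, Real.norm_eq_abs, abs_of_nonneg hb] at key
  convert key using 2
  module

/-- A perturbed Euler scheme follows the trajectories. -/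
theorem norm_sub_trajectory_le {F : E → E} {γ : ℝ → E} {L : NNReal} {H : ℝ}
    (h : IsTrajectory F γ) (hF : LipschitzWith L F) (hH0 : 0 ≤ H) (hH : ∀ x, ‖F x‖ ≤ H)
    {y ξ : ℕ → E} {b τ : ℕ → ℝ} {ζ : ℕ → E} (hb : ∀ n, 0 ≤ b n)
    (hτ : ∀ n, τ (n + 1) = τ n + b n) (hζ : ∀ n, ζ (n + 1) = ζ n + b n • ξ n)
    (hy : ∀ n, y (n + 1) = y n + b n • (F (y n) + ξ n)) {n : ℕ} {β η : ℝ}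
    (hβ : ∀ k ≥ n, b k ≤ β) (hη : ∀ k ≥ n, ‖ζ k - ζ n‖ ≤ η) {m : ℕ} (hm : n ≤ m) :
    ‖y m - γ (τ m - τ n)‖ ≤ Real.exp (L * (τ m - τ n)) * (‖y n - γ 0‖ + η + H * β) := by
  have hη0 : 0 ≤ η := (norm_nonneg _).trans (hη n le_rfl)
  have hβ0 : 0 ≤ β := (hb n).trans (hβ n le_rfl)
  set c := η + H * β with hc
  have hc0 : 0 ≤ c := by positivity
  -- Removing the accumulated noise from the error means that only the size `η` of its partial sums
  -- matters, not the sizes of single terms. With the offset `c`, the recursion becomes `‖e (k + 1)‖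
  -- + c ≤ (1 + L * b k) * (‖e k‖ + c)`.
  set e : ℕ → E := fun k => y k - γ (τ k - τ n) - (ζ k - ζ n) with he
  have hye : ∀ k ≥ n, ‖y k - γ (τ k - τ n)‖ ≤ ‖e k‖ + η := fun k hk => by
    have : y k - γ (τ k - τ n) = e k + (ζ k - ζ n) := by simp only [he]; abel
    rw [this]
    exact (norm_add_le _ _).trans (by linarith [hη k hk])
  have hmain : ∀ k ≥ n, ‖e k‖ + c ≤ Real.exp (L * (τ k - τ n)) * (‖y n - γ 0‖ + c) := by
    intro k hk
    induction k, hk using Nat.le_induction with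
    | base => simp [he]
    | succ k hk ih =>
      set s := τ k - τ n with hs
      have hs' : τ (k + 1) - τ n = s + b k := by rw [hτ, hs]; ring
      have hek : e (k + 1) = e k + b k • (F (y k) - F (γ s))
          - (γ (s + b k) - (γ s + b k • F (γ s))) := by
        simp only [he]
        rw [hs', hy, hζ, ← hs]
        module
      have h1 : ‖b k • (F (y k) - F (γ s))‖ ≤ b k * (L * (‖e k‖ + η)) := by
        rw [norm_smul, Real.norm_eq_abs, abs_of_nonneg (hb k)]
        refine mul_le_mul_of_nonneg_left ?_ (hb k)
        have h2 := hF.dist_le_mul (y k) (γ s)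
        rw [dist_eq_norm, dist_eq_norm] at h2
        exact h2.trans (mul_le_mul_of_nonneg_left (hye k hk) L.2)
      have h2 := h.norm_euler_sub_le hF hH s (hb k)
      have h3 : L * H * b k * b k ≤ L * H * b k * β :=
        mul_le_mul_of_nonneg_left (hβ k hk)
          (mul_nonneg (mul_nonneg L.2 hH0) (hb k))
      have h4 : ‖e (k + 1)‖ + c ≤ (1 + L * b k) * (‖e k‖ + c) := by
        have h5 : ‖e (k + 1)‖ ≤ ‖e k‖ + b k * (L * (‖e k‖ + η)) + L * H * b k * b k := by
          rw [hek]
          refine (norm_sub_le _ _).trans (add_le_add ((norm_add_le _ _).trans ?_) h2)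
          gcongr
        have h6 : (1 + L * b k) * (‖e k‖ + c)
            = ‖e k‖ + b k * (L * (‖e k‖ + η)) + L * H * b k * β + c := by rw [hc]; ring
        linarith
      rw [hs', mul_add (L : ℝ), Real.exp_add]
      calc ‖e (k + 1)‖ + c ≤ (1 + L * b k) * (‖e k‖ + c) := h4
        _ ≤ Real.exp (L * b k) * (Real.exp (L * s) * (‖y n - γ 0‖ + c)) := by
            refine mul_le_mul (by linarith [Real.add_one_le_exp (L * b k)]) ih (by positivity)
              (Real.exp_pos _).le
        _ = _ := by ring
  have h1 := hye m hm
  have h2 := hmain m hm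
  have h3 : ‖y n - γ 0‖ + η + H * β = ‖y n - γ 0‖ + c := by rw [hc]; ring
  have h4 : 0 ≤ H * β := by positivity
  rw [h3]
  linarith

/-- Over bounded time spans, a perturbed Euler scheme with vanishing step sizes and convergent
noise is eventually close to the trajectories started nearby. -/
theorem exists_forall_norm_sub_trajectory_lt {F : E → E} {L : NNReal} {H : ℝ}
    (hF : LipschitzWith L F) (hH0 : 0 ≤ H) (hH : ∀ x, ‖F x‖ ≤ H)
    {y ξ : ℕ → E} {b τ : ℕ → ℝ} {ζ : ℕ → E} (hb : ∀ n, 0 ≤ b n) (hb0 : Tendsto b atTop (𝓝 0))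
    (hτ : ∀ n, τ (n + 1) = τ n + b n) (hζ : ∀ n, ζ (n + 1) = ζ n + b n • ξ n)
    (hζc : CauchySeq ζ)
    (hy : ∀ n, y (n + 1) = y n + b n • (F (y n) + ξ n)) (T : ℝ) {ε : ℝ} (hε : 0 < ε) :
    ∃ δ > 0, ∃ n₀, ∀ n ≥ n₀, ∀ m ≥ n, τ m - τ n ≤ T → ∀ γ, IsTrajectory F γ →
      ‖y n - γ 0‖ < δ → ‖y m - γ (τ m - τ n)‖ < ε := by
  set X := Real.exp (L * T) with hX
  have hX0 : 0 < X := Real.exp_pos _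
  -- Initial distance, noise and discretization each contribute at most `δ`, and each is magnified
  -- by at most `X`; the factor 4 leaves room for strict inequality.
  set δ := ε / (4 * X) with hδ
  have hδ0 : 0 < δ := by positivity
  obtain ⟨n₁, hn₁⟩ := Metric.cauchySeq_iff.1 hζc δ hδ0
  have hβ : 0 < δ / (H + 1) := by positivity
  obtain ⟨n₂, hn₂⟩ := eventually_atTop.1 (hb0.eventually (gt_mem_nhds hβ))
  refine ⟨δ, hδ0, max n₁ n₂, fun n hn m hm hT γ hγ hyγ => ?_⟩
  have h1 := norm_sub_trajectory_le hγ hF hH0 hH hb hτ hζ hy (n := n) (β := δ / (H + 1)) (η := δ)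
    (fun k hk => (hn₂ k (le_trans (le_max_right _ _) (hn.trans hk))).le)
    (fun k hk => by
      rw [← dist_eq_norm]
      exact (hn₁ k (le_trans (le_max_left _ _) (hn.trans hk)) n
        (le_trans (le_max_left _ _) hn)).le) hm
  have h2 : H * (δ / (H + 1)) ≤ δ := by
    rw [mul_div_assoc', div_le_iff₀ (by positivity)]; nlinarith
  have h3 : Real.exp (L * (τ m - τ n)) ≤ X :=
    Real.exp_le_exp.2 (mul_le_mul_of_nonneg_left hT L.2)
  calc _ ≤ Real.exp (L * (τ m - τ n)) * (‖y n - γ 0‖ + δ + H * (δ / (H + 1))) := h1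
    _ ≤ X * (3 * δ) := by
        refine mul_le_mul h3 (by linarith) (by positivity) hX0.le
    _ < X * (4 * δ) := by gcongr; norm_num
    _ = ε := by rw [hδ]; field_simp

end Flow

end AdaptiveSA

/-! ### The cluster set of a bounded scheme and its chain transitivity. -/

namespace AdaptiveSA

theorem exists_nat_chain_of_transGen {α : Type*} {r : α → α → Prop} {x y : α}
    (h : Relation.TransGen r x y) :
    ∃ n : ℕ, 1 ≤ n ∧ ∃ p : ℕ → α, p 0 = x ∧ p n = y ∧ ∀ i < n, r (p i) (p (i + 1)) := by
  induction h with
  | @single y hxy =>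
    refine ⟨1, le_rfl, fun i => if i = 0 then x else y, by simp, by simp, fun i hi => ?_⟩
    obtain rfl : i = 0 := by omega
    simpa using hxy
  | @tail y z _ hyz ih =>
    obtain ⟨n, hn, p, h0, hp, hr⟩ := ih
    refine ⟨n + 1, by omega, fun i => if i ≤ n then p i else z, by simp [h0], by simp,
      fun i hi => ?_⟩
    rcases Nat.lt_or_ge i n with hin | hin
    · simpa [hin.le, Nat.succ_le_of_lt hin] using hr i hin
    · obtain rfl : i = n := by omega
      simpa [hp] using hyz

/-- Partial sums of small nonnegative steps approximately hit every level. -/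
theorem exists_hitting_after {b τ : ℕ → ℝ} (hτ : ∀ n, τ (n + 1) = τ n + b n)
    (hτt : Tendsto τ atTop atTop) {n : ℕ} {β : ℝ} (hβ0 : 0 ≤ β) (hβ : ∀ k ≥ n, b k ≤ β) {s : ℝ}
    (hs : 0 ≤ s) : ∃ m ≥ n, s ≤ τ m - τ n ∧ τ m - τ n ≤ s + β := by
  classical
  have hex : ∃ m, n ≤ m ∧ s ≤ τ m - τ n := by
    obtain ⟨m, hm⟩ := ((eventually_ge_atTop n).and (hτt.eventually_ge_atTop (s + τ n))).exists
    exact ⟨m, hm.1, by linarith [hm.2]⟩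
  obtain ⟨h1, h2⟩ := Nat.find_spec hex
  refine ⟨Nat.find hex, h1, h2, ?_⟩
  rcases Nat.eq_or_lt_of_le h1 with he | hlt
  · rw [← he]; simp; linarith
  · obtain ⟨k, hk⟩ : ∃ k, Nat.find hex = k + 1 := Nat.exists_eq_succ_of_ne_zero (by omega)
    have hnot := Nat.find_min hex (m := k) (by omega)
    have hnk : n ≤ k := by omega
    push Not at hnot
    rw [hk, hτ]
    linarith [hnot hnk, hβ k hnk]

/-- This is used to look a time `s` into the past. If no index landed in the window `[s, s + β]`,
steps of size at most `β` could never bring the remaining time below `s`, although it is zero at the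
final index. -/
theorem exists_hitting_before {b τ : ℕ → ℝ} (hτ : ∀ n, τ (n + 1) = τ n + b n)
    {j n : ℕ} (hjn : j ≤ n) {β : ℝ} (hβ : ∀ k ≥ j, b k ≤ β) {s : ℝ}
    (hs : 0 < s) (hn : s ≤ τ n - τ j) :
    ∃ m, j ≤ m ∧ m ≤ n ∧ s ≤ τ n - τ m ∧ τ n - τ m ≤ s + β := by
  induction n, hjn using Nat.le_induction with
  | base => simp at hn; linarith
  | succ n hjn ih =>
    clear ih
    by_contra! hcon
    have key : ∀ k, j ≤ k → k ≤ n + 1 → s ≤ τ (n + 1) - τ k := by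
      intro k hk
      induction k, hk using Nat.le_induction with
      | base => exact fun _ => hn
      | succ k hk ih =>
        intro hkn
        have h1 := hcon k hk (by omega) (ih (by omega))
        have h2 := hτ k
        have h3 := hβ k hk
        linarith
    have := key (n + 1) (by omega) le_rfl
    simp at this
    linarith

section LimitSet

variable {d : ℕ}

/-- The limit set of a bounded perturbed Euler scheme with vanishing, non-summable step sizes and
convergent noise is internally chain transitive. -/
theorem exists_internallyChainTransitive {h : Vec d → Vec d} (hh : LocallyLipschitz h)
    {y ξ : ℕ → Vec d} {b : ℕ → ℝ} {R : ℝ} (hR : ∀ n, ‖y n‖ ≤ R) (hb : ∀ n, 0 ≤ b n)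
    (hb0 : Tendsto b atTop (𝓝 0))
    (hbs : Tendsto (fun n => ∑ i ∈ Finset.range n, b i) atTop atTop)
    (hξ : ∃ l, Tendsto (fun n => ∑ i ∈ Finset.range n, b i • ξ i) atTop (𝓝 l))
    (hy : ∀ n, y (n + 1) = y n + b n • (h (y n) + ξ n)) :
    ∃ A : Set (Vec d), InternallyChainTransitive h A ∧
      Tendsto (fun n => Metric.infDist (y n) A) atTop (𝓝 0) := by
  -- The iterates and their cluster points stay in the ball where `F = h`, so `F` may replace `h`;
  -- its trajectories exist for all times.
  obtain ⟨F, L, H, hF, hH0, hH, hFh⟩ := exists_lipschitz_bounded_extension hh R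
  have hyF : ∀ n, y (n + 1) = y n + b n • (F (y n) + ξ n) := fun n => by
    rw [hFh _ (hR n)]; exact hy n
  obtain ⟨τ, hτdef⟩ : ∃ τ : ℕ → ℝ, τ = fun n => ∑ i ∈ Finset.range n, b i := ⟨_, rfl⟩
  obtain ⟨ζ, hζdef⟩ : ∃ ζ : ℕ → Vec d, ζ = fun n => ∑ i ∈ Finset.range n, b i • ξ i := ⟨_, rfl⟩
  have hτ : ∀ n, τ (n + 1) = τ n + b n := fun n => by simp [hτdef, Finset.sum_range_succ]
  have hζ : ∀ n, ζ (n + 1) = ζ n + b n • ξ n := fun n => by simp [hζdef, Finset.sum_range_succ]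
  have hτt : Tendsto τ atTop atTop := by rw [hτdef]; exact hbs
  have hζc : CauchySeq ζ := by
    obtain ⟨l, hl⟩ := hξ
    rw [hζdef]; exact hl.cauchySeq
  have hτmono : Monotone τ := monotone_nat_of_le_succ fun n => by rw [hτ]; linarith [hb n]
  have track := fun (T : ℝ) (ε : ℝ) (hε : 0 < ε) =>
    exists_forall_norm_sub_trajectory_lt hF hH0 hH hb hb0 hτ hζ hζc hyF T hε
  have hsmall : ∀ β > (0 : ℝ), ∃ n₀, ∀ n ≥ n₀, b n ≤ β := fun β hβ => by
    obtain ⟨n₀, hn₀⟩ := eventually_atTop.1 (hb0.eventually (gt_mem_nhds hβ))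
    exact ⟨n₀, fun n hn => (hn₀ n hn).le⟩
  set A : Set (Vec d) := {p | MapClusterPt p atTop y} with hA
  have hAiff : ∀ p, p ∈ A ↔ ∀ ε > 0, ∀ n₀, ∃ n ≥ n₀, ‖y n - p‖ < ε := fun p => by
    rw [hA, mem_ofPred_eq, Metric.nhds_basis_ball.mapClusterPt_iff_frequently]
    simp only [frequently_atTop, Metric.mem_ball, dist_eq_norm]
  have hAsub : ∀ (φ : ℕ → ℕ) (p : Vec d), Tendsto φ atTop atTop →
      Tendsto (y ∘ φ) atTop (𝓝 p) → p ∈ A := fun φ p hφ hp =>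
    MapClusterPt.of_comp hφ hp.mapClusterPt
  have hsub : ∀ φ : ℕ → ℕ, ∃ p, ∃ θ : ℕ → ℕ, StrictMono θ ∧
      Tendsto (y ∘ φ ∘ θ) atTop (𝓝 p) := fun φ => by
    obtain ⟨p, -, θ, hθ, hp⟩ := tendsto_subseq_of_bounded
      (Metric.isBounded_closedBall (x := (0 : Vec d)) (r := R)) (x := y ∘ φ)
      (fun n => mem_closedBall_zero_iff.2 (hR _))
    exact ⟨p, θ, hθ, hp⟩
  have hAR : ∀ p ∈ A, ‖p‖ ≤ R := fun p hp => le_of_forall_pos_le_add fun ε hε => by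
    obtain ⟨n, -, hn⟩ := (hAiff p).1 hp ε hε 0
    have h1 : ‖p‖ ≤ ‖y n‖ + ‖y n - p‖ := by
      simpa using norm_sub_le (y n) (y n - p)
    linarith [hR n]
  have hAne : A.Nonempty := by
    obtain ⟨p, θ, hθ, hp⟩ := hsub id
    exact ⟨p, hAsub θ p hθ.tendsto_atTop hp⟩
  have hAc : IsCompact A := by
    refine (isCompact_closedBall (0 : Vec d) R).of_isClosed_subset ?_
      fun p hp => mem_closedBall_zero_iff.2 (hAR p hp)
    exact isClosed_setOfPred_clusterPt
  have hnear : ∀ ε > 0, ∃ n₀, ∀ n ≥ n₀, ∃ p ∈ A, ‖y n - p‖ < ε := by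
    intro ε hε
    by_contra! hcon
    choose φ hφ hφA using hcon
    obtain ⟨p, θ, hθ, hp⟩ := hsub φ
    have hφt : Tendsto (φ ∘ θ) atTop atTop :=
      (tendsto_atTop_mono hφ tendsto_id).comp hθ.tendsto_atTop
    have hpA := hAsub _ p hφt hp
    obtain ⟨n, hn⟩ := (Metric.tendsto_atTop.1 hp ε hε)
    have := hn n le_rfl
    rw [dist_eq_norm] at this
    exact absurd this (not_lt.2 (hφA (θ n) p hpA))
  have hforward : ∀ γ, IsTrajectory F γ → γ 0 ∈ A → ∀ s, 0 ≤ s → γ s ∈ A := by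
    intro γ hγ h0 s hs
    refine (hAiff _).2 fun ε hε n₀ => ?_
    obtain ⟨δ, hδ, n₁, hn₁⟩ := track (s + 1) (ε / 2) (by positivity)
    -- The bound 1 keeps the overshoot within the tracked time span `s + 1`; the other bound makes
    -- the motion during the overshoot, at speed at most `H`, smaller than `ε / 2`.
    have hβ0 : 0 < min 1 (ε / 2 / (H + 1)) := lt_min one_pos (by positivity)
    obtain ⟨n₂, hn₂⟩ := hsmall _ hβ0
    obtain ⟨n, hn, hyn⟩ := (hAiff _).1 h0 δ hδ (max n₀ (max n₁ n₂))
    simp only [ge_iff_le, max_le_iff] at hn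
    obtain ⟨m, hm, hsm, hsm'⟩ := exists_hitting_after hτ hτt hβ0.le
      (fun k hk => hn₂ k (hn.2.2.trans hk)) hs
    refine ⟨m, hn.1.trans hm, ?_⟩
    have h1 := hn₁ n hn.2.1 m hm (hsm'.trans (by linarith [min_le_left 1 (ε / 2 / (H + 1))]))
      γ hγ hyn
    have h2 := hγ.norm_sub_le hH s (τ m - τ n)
    rw [abs_of_nonneg (by linarith)] at h2
    have h3 : H * (τ m - τ n - s) ≤ ε / 2 := by
      have h4 : τ m - τ n - s ≤ ε / 2 / (H + 1) := by
        linarith [min_le_right 1 (ε / 2 / (H + 1))]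
      rw [le_div_iff₀ (by positivity)] at h4
      linarith
    have h5 : ‖y m - γ s‖ ≤ ‖y m - γ (τ m - τ n)‖ + ‖γ (τ m - τ n) - γ s‖ :=
      norm_sub_le_norm_sub_add_norm_sub _ _ _
    linarith
  have hbackward : ∀ p ∈ A, ∀ s, 0 < s → ∃ q ∈ A, ∀ γ, IsTrajectory F γ → γ 0 = q → γ s = p := by
    intro p hp s hs
    -- The backward point `q` is a limit of iterates taken about a time `s` before visits near `p`;
    -- tracking then carries the trajectory from `q` to `p`.
    have hex : ∀ j : ℕ, ∃ m n, j ≤ m ∧ m ≤ n ∧ s ≤ τ n - τ m ∧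
        τ n - τ m ≤ s + 1 / ((j : ℝ) + 1) ∧ ‖y n - p‖ < 1 / ((j : ℝ) + 1) := by
      intro j
      have hj : (0 : ℝ) < 1 / ((j : ℝ) + 1) := by positivity
      obtain ⟨n₀, hn₀⟩ := hsmall _ hj
      obtain ⟨n₁, hn₁⟩ := eventually_atTop.1 (hτt.eventually_ge_atTop (s + τ (max j n₀)))
      obtain ⟨n, hn, hyn⟩ := (hAiff p).1 hp _ hj (max (max j n₀) n₁)
      simp only [ge_iff_le, max_le_iff] at hn
      obtain ⟨m, hjm, hmn, h1, h2⟩ := exists_hitting_before hτ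
        (max_le hn.1.1 hn.1.2) (fun k hk => hn₀ k ((le_max_right _ _).trans hk)) hs
        (by linarith [hn₁ n hn.2])
      exact ⟨m, n, (le_max_left _ _).trans hjm, hmn, h1, h2, hyn⟩
    choose m n hjm hmn h1 h2 h3 using hex
    obtain ⟨q, θ, hθ, hq⟩ := hsub m
    refine ⟨q, hAsub _ q ((tendsto_atTop_mono hjm tendsto_id).comp hθ.tendsto_atTop) hq,
      fun γ hγ hγ0 => ?_⟩
    have hle : ∀ ε > 0, ‖γ s - p‖ ≤ ε := by
      intro ε hε
      obtain ⟨δ, hδ, n₁, hn₁⟩ := track (s + 1) (ε / 2) (by positivity)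
      have e1 : ∀ᶠ j in atTop, ‖y (m (θ j)) - q‖ < δ := by
        have := hq.eventually (Metric.ball_mem_nhds q hδ)
        simpa [dist_eq_norm] using this
      have e2 : ∀ᶠ j in atTop, n₁ ≤ θ j := hθ.tendsto_atTop.eventually_ge_atTop n₁
      have e3 : ∀ᶠ j in atTop, 1 / ((θ j : ℝ) + 1) < ε / 2 / (H + 1) :=
        (tendsto_one_div_add_atTop_nhds_zero_nat.comp hθ.tendsto_atTop).eventually
          (gt_mem_nhds (by positivity))
      obtain ⟨j, ha, hb', hc⟩ := (e1.and (e2.and e3)).exists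
      have k1 := hn₁ (m (θ j)) (hb'.trans (hjm _)) (n (θ j)) (hmn _)
        ((h2 _).trans (by
          have : 1 / ((θ j : ℝ) + 1) ≤ 1 := by
            rw [div_le_one (by positivity)]; linarith [Nat.cast_nonneg (α := ℝ) (θ j)]
          linarith)) γ hγ (by rw [hγ0]; exact ha)
      have k2 := hγ.norm_sub_le hH (τ (n (θ j)) - τ (m (θ j))) s
      rw [abs_sub_comm, abs_of_nonneg (by linarith [h1 (θ j)])] at k2
      have k3 : H * (τ (n (θ j)) - τ (m (θ j)) - s) ≤ H * (1 / ((θ j : ℝ) + 1)) :=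
        mul_le_mul_of_nonneg_left (by linarith [h2 (θ j)]) hH0
      rw [lt_div_iff₀ (by positivity)] at hc
      have k4 := norm_sub_le_norm_sub_add_norm_sub (γ s) (γ (τ (n (θ j)) - τ (m (θ j)))) p
      have k5 := norm_sub_le_norm_sub_add_norm_sub (γ (τ (n (θ j)) - τ (m (θ j)))) (y (n (θ j))) p
      rw [norm_sub_rev _ (y (n (θ j)))] at k5
      linarith [h3 (θ j)]
    have h0 : ‖γ s - p‖ ≤ 0 := le_of_forall_pos_le_add fun ε hε => by simpa using hle ε hε
    exact sub_eq_zero.1 (norm_le_zero_iff.1 h0)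
  have hinv : ∀ γ, IsTrajectory F γ → γ 0 ∈ A → ∀ t, γ t ∈ A := by
    intro γ hγ h0 t
    rcases le_or_gt 0 t with ht | ht
    · exact hforward γ hγ h0 t ht
    · obtain ⟨q, hqA, hq⟩ := hbackward _ h0 (-t) (by linarith)
      obtain ⟨γ', h0', hγ'⟩ := exists_isTrajectory hF hH0 hH q
      have e := IsTrajectory.eq hF hγ (hγ'.comp_add (-t)) (t₀ := 0)
        (by simpa using (hq γ' hγ' h0').symm)
      have : γ t = q := by
        rw [e]; simpa using h0'
      rwa [this]
  have htraj : ∀ p ∈ A, ∃ γ, γ 0 = p ∧ IsTrajectory F γ ∧ (∀ t, HasDerivAt γ (h (γ t)) t) ∧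
      ∀ t, γ t ∈ A := by
    intro p hp
    obtain ⟨γ, h0, hγ⟩ := exists_isTrajectory hF hH0 hH p
    have hmem := hinv γ hγ (by rwa [h0])
    exact ⟨γ, h0, hγ, fun t => by rw [← hFh _ (hAR _ (hmem t))]; exact hγ t, hmem⟩
  have hchain : ∀ x ∈ A, ∀ x' ∈ A, ∀ ε > (0 : ℝ), ∀ T > (0 : ℝ),
      Relation.TransGen (fun u v => u ∈ A ∧ v ∈ A ∧ Reaches h ε T u v) x x' := by
    intro x hx x' hx' ε hε T hT
    obtain ⟨δ, hδ, n₁, hn₁⟩ := track (3 * T) (ε / 2) (by positivity)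
    -- Closeness `δ` at the start of a piece allows tracking; closeness `ε / 2` at its end allows
    -- the iterate to be replaced by a point of `A`.
    set δ' := min δ (ε / 2) with hδ'
    have hδ'0 : 0 < δ' := lt_min hδ (by positivity)
    obtain ⟨n₂, hn₂⟩ := hnear δ' hδ'0
    obtain ⟨n₃, hn₃⟩ := hsmall T hT
    have hstep : ∀ n ≥ n₁, ∀ m ≥ n, T ≤ τ m - τ n → τ m - τ n ≤ 3 * T → ∀ u ∈ A, ∀ v ∈ A,
        ‖y n - u‖ < δ' → ‖y m - v‖ < δ' → Reaches h ε T u v := by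
      intro n hn m hm h1 h2 u hu v hv hnu hmv
      obtain ⟨γ, h0, hγ, hγh, -⟩ := htraj u hu
      refine ⟨γ, h0, fun t _ => (hγh t).hasDerivWithinAt, τ m - τ n, h1, ?_⟩
      have k1 := hn₁ n hn m hm h2 γ hγ (by rw [h0]; exact hnu.trans_le (min_le_left _ _))
      have k2 := hmv.trans_le (min_le_right _ _)
      rw [dist_eq_norm]
      have k3 := norm_sub_le_norm_sub_add_norm_sub (γ (τ m - τ n)) (y m) v
      rw [norm_sub_rev _ (y m)] at k3
      linarith
    -- A stretch longer than `3 * T` loses an initial piece of duration between `T` and `2 * T`,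
    -- which leaves at least `T` for the induction on the number of steps. Every piece is thus long
    -- enough for a chain link and short enough to be tracked.
    have hgen : ∀ l n m : ℕ, m - n ≤ l → max n₁ (max n₂ n₃) ≤ n → n ≤ m → T ≤ τ m - τ n →
        ∀ u ∈ A, ∀ v ∈ A, ‖y n - u‖ < δ' → ‖y m - v‖ < δ' →
        Relation.TransGen (fun u v => u ∈ A ∧ v ∈ A ∧ Reaches h ε T u v) u v := by
      intro l
      induction l with
      | zero =>
        intro n m hl _ hnm hT'
        obtain rfl : n = m := by omega
        simp at hT'; linarith
      | succ l ih =>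
        intro n m hl hn hnm hT' u hu v hv hnu hmv
        have hn' := hn
        simp only [max_le_iff] at hn'
        rcases le_or_gt (τ m - τ n) (3 * T) with h3 | h3
        · exact .single ⟨hu, hv, hstep n hn'.1 m hnm hT' h3 u hu v hv hnu hmv⟩
        · obtain ⟨k, hk, hk1, hk2⟩ := exists_hitting_after hτ hτt hT.le
            (fun k hk => hn₃ k (hn'.2.2.trans hk)) hT.le
          have hkm : k ≤ m := by
            by_contra hlt
            have := hτmono (not_le.1 hlt).le
            linarith
          have hnk : n < k := by
            rcases hk.lt_or_eq with hlt | heq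
            · exact hlt
            · rw [heq] at hk1; simp at hk1; linarith
          obtain ⟨w, hw, hkw⟩ := hn₂ k (hn'.2.1.trans hk)
          refine Relation.TransGen.head
            ⟨hu, hw, hstep n hn'.1 k hk hk1 (by linarith) u hu w hw hnu hkw⟩ ?_
          exact ih k m (by omega) (hn.trans hk) hkm (by linarith) w hw v hv hkw hmv
    obtain ⟨n, hn, hnx⟩ := (hAiff x).1 hx δ' hδ'0 (max n₁ (max n₂ n₃))
    obtain ⟨k, hk⟩ := eventually_atTop.1 (hτt.eventually_ge_atTop (T + τ n))
    obtain ⟨m, hm, hmx⟩ := (hAiff x').1 hx' δ' hδ'0 (max n k)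
    simp only [ge_iff_le, max_le_iff] at hm
    exact hgen _ n m le_rfl hn hm.1 (by linarith [hk m hm.2]) x hx x' hx' hnx hmx
  refine ⟨A, ⟨hAne, hAc, fun p hp => ?_, fun x hx x' hx' ε hε T hT => ?_⟩, ?_⟩
  · obtain ⟨γ, h0, -, hγ, hmem⟩ := htraj p hp
    exact ⟨γ, h0, hγ, hmem⟩
  · obtain ⟨n, hn, p, hp0, hpn, hr⟩ :=
      exists_nat_chain_of_transGen (hchain x hx x' hx' ε hε T hT)
    refine ⟨n, hn, p, hp0, hpn, fun i hi => ?_, fun i hi => (hr i hi).2.2⟩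
    rcases hi.lt_or_eq with hlt | rfl
    · exact (hr i hlt).1
    · rwa [hpn]
  · rw [Metric.tendsto_atTop]
    intro ε hε
    obtain ⟨n₀, hn₀⟩ := hnear ε hε
    refine ⟨n₀, fun n hn => ?_⟩
    obtain ⟨p, hp, hnp⟩ := hn₀ n hn
    rw [Real.dist_0_eq_abs, abs_of_nonneg Metric.infDist_nonneg]
    exact (Metric.infDist_le_dist_of_mem hp).trans_lt (by rwa [dist_eq_norm])

end LimitSet

end AdaptiveSA

/-! ### The natural filtration and assembly of the proof. -/

namespace AdaptiveSA

/-- The `σ`-algebras `F_n = σ(y₀, M₁, …, M_n)` form a filtration. -/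
def historyFiltration {Ω : Type*} [mΩ : MeasurableSpace Ω] {d : ℕ} {y₀ : Ω → Vec d}
    {M : ℕ → Ω → Vec d} (hy : Measurable y₀) (hM : ∀ n, Measurable (M (n + 1))) :
    Filtration ℕ mΩ where
  seq := history y₀ M
  mono' _ _ hij := sup_le_sup_left
    (biSup_mono fun _ hk => Finset.Icc_subset_Icc_right hij hk) _
  le' n := by
    refine sup_le hy.comap_le (iSup₂_le fun i hi => ?_)
    -- The value `M 0` never enters the history, so measurability is needed only for positive
    -- indices.
    obtain ⟨k, rfl⟩ := Nat.exists_eq_succ_of_ne_zero (by have := Finset.mem_Icc.1 hi; omega : i ≠ 0)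
    exact (hM k).comap_le

theorem measurable_history_noise {Ω : Type*} {d : ℕ} (y₀ : Ω → Vec d) (M : ℕ → Ω → Vec d) (n : ℕ) :
    Measurable[history y₀ M (n + 1)] (M (n + 1)) :=
  Measurable.mono (comap_measurable (M (n + 1)))
    (le_sup_of_le_right (le_iSup₂_of_le (n + 1) (Finset.mem_Icc.2 ⟨by omega, le_rfl⟩) le_rfl)) le_rfl

theorem measurable_history_iterate {Ω : Type*} {d : ℕ} {h : Vec d → Vec d} {g : Vec d → ℝ}
    {a : ℕ → ℝ} {M y : ℕ → Ω → Vec d} (hh : Measurable h) (hg : Measurable g)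
    (hy : ∀ n ω, y (n + 1) ω = y n ω + (a n / g (y n ω)) • (h (y n ω) + M (n + 1) ω)) (n : ℕ) :
    Measurable[history (y 0) M n] (y n) := by
  induction n with
  | zero => exact Measurable.mono (comap_measurable (y 0)) le_sup_left le_rfl
  | succ n ih =>
    have hmono : history (y 0) M n ≤ history (y 0) M (n + 1) := sup_le_sup_left
      (biSup_mono fun _ hk => Finset.Icc_subset_Icc_right n.le_succ hk) _
    have h1 : Measurable[history (y 0) M (n + 1)] (y n) := ih.mono hmono le_rfl
    have h2 := measurable_history_noise (y 0) M n
    have h3 : y (n + 1) = fun ω => y n ω + (a n / g (y n ω)) • (h (y n ω) + M (n + 1) ω) :=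
      funext (hy n)
    rw [h3]
    exact h1.add ((measurable_const.div (hg.comp h1)).smul ((hh.comp h1).add h2))

end AdaptiveSA

theorem mainTheorem3 {Ω : Type*} [MeasurableSpace Ω] (μ : Measure Ω) [IsProbabilityMeasure μ]
    {d : ℕ}
    (h : AdaptiveSA.Vec d → AdaptiveSA.Vec d) (f g W : AdaptiveSA.Vec d → ℝ) (a : ℕ → ℝ)
    (M₀ : ℕ) (N : ℕ∞) (c : ℝ)
    (M y : ℕ → Ω → AdaptiveSA.Vec d)
    -- (A1)
    (hh : LocallyLipschitz h)
    -- (A2)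
    (ha_nonneg : ∀ n, 0 ≤ a n)
    (ha_sum : Tendsto (fun n => ∑ i ∈ Finset.range n, a i) atTop atTop)
    (ha_sq : Summable fun n => a n ^ 2)
    -- (A3)
    (hM_meas : ∀ n, Measurable (M (n + 1)))
    (hM_sq : ∀ n, MemLp (M (n + 1)) 2 μ)
    (hM_mart : ∀ n, μ[M (n + 1) | AdaptiveSA.history (y 0) M n] =ᵐ[μ] 0)
    (hf_nonneg : ∀ x, 0 ≤ f x) (hf_meas : Measurable f) (hf_bdd : AdaptiveSA.LocallyBounded f)
    (hM_var : ∀ n, μ[fun ω => ‖M (n + 1) ω‖ ^ 2 | AdaptiveSA.history (y 0) M n]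
      ≤ᵐ[μ] fun ω => f (y n ω))
    -- (A4)
    (hW_nonneg : ∀ x, 0 ≤ W x)
    (hW_coercive : Tendsto W (Bornology.cobounded (AdaptiveSA.Vec d)) atTop)
    (hM₀ : 0 < M₀)
    (hW_desc : ∀ x, (M₀ : ℝ) ≤ W x → inner ℝ (h x) (gradient W x) < 0)
    -- (A5)
    (hW_smooth : ContDiff ℝ 2 W)
    (hW_second : ∃ C : ℝ, ∀ (x : AdaptiveSA.Vec d) (i j : Fin d),
      |fderiv ℝ (fun z => fderiv ℝ W z (EuclideanSpace.single j (1 : ℝ))) x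
        (EuclideanSpace.single i (1 : ℝ))| ≤ C)
    -- the choice of `N`, `c_N` and `g`
    (hN : (M₀ : ℕ∞) < N)
    (hc : max 1 (⨆ z ∈ closure (AdaptiveSA.sublevel W N) \ AdaptiveSA.sublevel W M₀,
      ENNReal.ofReal ((‖h z‖ ^ 2 + f z) / W z)) < ENNReal.ofReal c)
    (hg_meas : Measurable g) (hg_bdd : AdaptiveSA.LocallyBounded g)
    (hg : ∀ z, max 1 ({z | (N : ℝ≥0∞) < ENNReal.ofReal (W z)}.indicator
      (fun z => √((‖h z‖ ^ 2 + f z) / W z)) z) ≤ g z)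
    -- the adaptively scaled iteration
    (hy_meas : Measurable (y 0))
    (hy : ∀ n ω, y (n + 1) ω = y n ω + (a n / g (y n ω)) • (h (y n ω) + M (n + 1) ω)) :
    ∀ᵐ ω ∂μ, ∃ A : Set (AdaptiveSA.Vec d), AdaptiveSA.InternallyChainTransitive h A ∧
      Tendsto (fun n => Metric.infDist (y n ω) A) atTop (𝓝 0) := by

  open AdaptiveSA in
  have hhc : Continuous h := hh.continuous
  have hg1 : ∀ z, 1 ≤ g z := fun z => (le_max_left _ _).trans (hg z)
  have hg0 : ∀ z, 0 < g z := fun z => one_pos.trans_le (hg1 z)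
  let ℱ := historyFiltration hy_meas hM_meas
  have hy_adp : ∀ n, StronglyMeasurable[ℱ n] (y n) := fun n =>
    (measurable_history_iterate hhc.measurable hg_meas hy n).stronglyMeasurable
  have hM_adp : ∀ n, StronglyMeasurable[ℱ (n + 1)] (M (n + 1)) := fun n =>
    (measurable_history_noise (y 0) M n).stronglyMeasurable
  obtain ⟨b, hb⟩ : ∃ b : ℕ → Ω → ℝ, b = fun n ω => a n / g (y n ω) := ⟨_, rfl⟩
  have hyb : ∀ n ω, y (n + 1) ω = y n ω + b n ω • (h (y n ω) + M (n + 1) ω) := by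
    rw [hb]; exact hy
  have hb_adp : ∀ n, StronglyMeasurable[ℱ n] (b n) := fun n => by
    rw [hb]
    exact (measurable_const.div (hg_meas.comp (hy_adp n).measurable)).stronglyMeasurable
  have hb_nonneg : ∀ n ω, 0 ≤ b n ω := fun n ω => by
    rw [hb]; exact div_nonneg (ha_nonneg n) (hg0 _).le
  have hb_le : ∀ n ω, b n ω ≤ a n := fun n ω => by
    rw [hb]; exact div_le_self (ha_nonneg n) (hg1 _)
  obtain ⟨ψ, G, L, hL, hψ, hG, hψ0, hGh, hWψ⟩ :=
    exists_lyapunov hW_coercive hW_desc hW_smooth hW_second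
  obtain ⟨K, hK, hgrow⟩ := exists_growth_bound hhc hf_bdd hW_nonneg hW_coercive hM₀ hc hg
  have hgrow' : ∀ n ω, b n ω ^ 2 * (‖h (y n ω)‖ ^ 2 + f (y n ω))
      ≤ a n ^ 2 * (K * (M₀ + 2) * (1 + ψ (y n ω))) := by
    intro n ω
    have h1 := hgrow (y n ω)
    -- The constant comes from `W ≤ ψ + (M₀ + 1)`.
    have h2 : 1 + W (y n ω) ≤ (M₀ + 2) * (1 + ψ (y n ω)) := by
      have := hWψ (y n ω)
      nlinarith [mul_nonneg (Nat.cast_nonneg (α := ℝ) M₀) (hψ0 (y n ω)), hψ0 (y n ω)]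
    have hgn := hg0 (y n ω)
    calc b n ω ^ 2 * (‖h (y n ω)‖ ^ 2 + f (y n ω))
        ≤ b n ω ^ 2 * (K * (1 + W (y n ω)) * g (y n ω) ^ 2) := by gcongr
      _ = a n ^ 2 * (K * (1 + W (y n ω))) := by rw [hb]; field_simp
      _ ≤ a n ^ 2 * (K * ((M₀ + 2) * (1 + ψ (y n ω)))) := by gcongr
      _ = _ := by ring
  have hstable := ae_bddAbove_lyapunov (ℱ := ℱ) hhc hf_nonneg (by positivity) hL ha_sq hM_sq
    hM_mart hM_var hy_adp hb_adp hb_nonneg hb_le hyb hψ hG hψ0 hGh hgrow'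
  have hnoise := ae_exists_tendsto_noise (ℱ := ℱ) hf_bdd ha_sq hM_adp hM_sq hM_mart hM_var
    hy_adp hb_adp hb_nonneg hb_le
  have ha_zero : Tendsto a atTop (𝓝 0) := by
    have h1 := ha_sq.tendsto_atTop_zero.sqrt
    simpa [Real.sqrt_sq (ha_nonneg _)] using h1
  filter_upwards [hstable, hnoise] with ω hω hω'
  obtain ⟨C, hC⟩ := hω
  obtain ⟨R, hR⟩ := exists_norm_le_of_le hW_coercive (C + (M₀ + 1))
  have hyR : ∀ n, ‖y n ω‖ ≤ R := fun n => hR _ (by linarith [hWψ (y n ω), hC n])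
  obtain ⟨Γ, -, hΓ⟩ := hg_bdd.exists_bound R
  have hgΓ : ∀ n, g (y n ω) ≤ Γ := fun n => (le_abs_self _).trans (hΓ _ (hyR n))
  have hΓ0 : 0 < Γ := (hg0 _).trans_le (hgΓ 0)
  refine exists_internallyChainTransitive hh (ξ := fun n => M (n + 1) ω) (b := fun n => b n ω)
    hyR (fun n => hb_nonneg n ω)
    (squeeze_zero (fun n => hb_nonneg n ω) (fun n => hb_le n ω) ha_zero) ?_
    (hω' ⟨R, hyR⟩) (fun n => hyb n ω)
  -- Along this path `g ≤ Γ`, so the scaled steps are at least `a n / Γ` and their sum diverges too.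
  refine tendsto_atTop_mono (fun n => ?_) (ha_sum.const_mul_atTop (inv_pos.2 hΓ0))
  rw [Finset.mul_sum]
  refine Finset.sum_le_sum fun i _ => ?_
  rw [hb, inv_mul_eq_div]
  exact div_le_div_of_nonneg_left (ha_nonneg i) (hg0 _) (hgΓ i)
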